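/- **Setting.** Let $T\ge 0$ and let $(\Omega,\mathcal F,\mathbb P)$ be a probability space with a filtration $(\mathcal F_t)_{t=0}^{T}$, $\mathcal F_0=\{\emptyset,\Omega\}$. The risk-free returns $r^0_1,\dots,r^0_T>0$ are deterministic, and $\rho_t=\prod_{k=t}^{T-1}r^0_{k+1}$, $\rho_T=1$. The excess returns $\boldsymbol r_t\in\mathbb R^N$ of $N$ risky assets and the states $\boldsymbol s_t\in\mathbb R^{N_s}$ are $\mathcal F_t$-measurable and satisfy $\boldsymbol r_t=\boldsymbol f(t,\boldsymbol s_t,\boldsymbol\epsilon_t)$ and $\boldsymbol s_t=\boldsymbol g(t,\boldsymbol s_{t-1},\boldsymbol\xi_t)$ for $t=1,\dots,T$, with deterministic functions $\boldsymbol f,\boldsymbol g$ and $\mathcal F_t$-measurable noises $\boldsymbol\epsilon_t,\boldsymbol\xi_t$; the initial state $\boldsymbol s_0$ is deterministic. For $t<T$ the conditional law of $(\boldsymbol r_{t+1},\boldsymbol s_{t+1})$ given $\mathcal F_t$ equals its conditional law given $\boldsymbol s_t$, and under this law $\boldsymbol r_{t+1}$ has almost surely finite second moments and a positive definite covariance matrix.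 For each $t<T$ let $\mathcal A_t\subseteq\mathbb R^N$ be a cone (containing $\boldsymbol 0$ and closed under multiplication by positive scalars), not necessarily convex. A policy is a sequence $(\boldsymbol\pi_t)_{t=0}^{T-1}$ of $\mathcal F_t$-measurable random vectors $\boldsymbol\pi_t$ with values in $\mathcal A_t$. It generates from the initial wealth $x_0\in\mathbb R$ the wealth $x_{t+1}=r^0_{t+1}x_t+\boldsymbol r_{t+1}^{\top}\boldsymbol\pi_t$. For $x_{\rm tg}\in\mathbb R$, problem $\mathcal P^2_{\rm mv}(x_{\rm tg})$ is to minimize $\mathrm{Var}[x_T]$ over the policies for which $x_T$ is integrable and $\mathrm E[x_T]=x_{\rm tg}$ (the feasible policies). Put $d_T^\pm=1$ and, for $t=T-1,\dots,0$, $$d_t^-(\boldsymbol s_t)=\inf_{\boldsymbol k\in\mathcal A_t}\mathrm E\big[(1-\boldsymbol r_{t+1}^{\top}\boldsymbol k)^2\big(d_{t+1}^-(\boldsymbol s_{t+1})\mathbb 1_{\{\boldsymbol r_{t+1}^{\top}\boldsymbol k\le 1\}}+d_{t+1}^+(\boldsymbol s_{t+1})\mathbb 1_{\{\boldsymbol r_{t+1}^{\top}\boldsymbol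 k>1\}}\big)\,\big|\,\boldsymbol s_t\big],$$ $$d_t^+(\boldsymbol s_t)=\inf_{\boldsymbol k\in\mathcal A_t}\mathrm E\big[(1+\boldsymbol r_{t+1}^{\top}\boldsymbol k)^2\big(d_{t+1}^-(\boldsymbol s_{t+1})\mathbb 1_{\{\boldsymbol r_{t+1}^{\top}\boldsymbol k\le -1\}}+d_{t+1}^+(\boldsymbol s_{t+1})\mathbb 1_{\{\boldsymbol r_{t+1}^{\top}\boldsymbol k>-1\}}\big)\,\big|\,\boldsymbol s_t\big],$$ and let $\boldsymbol k_t^-(\boldsymbol s_t),\boldsymbol k_t^+(\boldsymbol s_t)\in\mathcal A_t$ denote measurable minimizers of the first and of the second problem. Write $d_0^\pm=d_0^\pm(\boldsymbol s_0)$. **Theorem.** If all the cones $\mathcal A_t$ are closed, then such minimizers $\boldsymbol k_t^\pm$ exist. Moreover: (i) If $\rho_0x_0<x_{\rm tg}$ and $d_0^-=1$, or if $\rho_0x_0>x_{\rm tg}$ and $d_0^+=1$, then $\mathcal P^2_{\rm mv}(x_{\rm tg})$ has no feasible policy. (ii) Let $\rho_0x_0\le x_{\rm tg}$ and $d_0^-<1$,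 and let $\boldsymbol k_t^\pm$ be any minimizers as above. Then the feedback policy $$\boldsymbol\pi_t^*(x_t,\boldsymbol s_t)=\Big(r^0_{t+1}x_t-\frac{x_{\rm tg}-\rho_0d_0^-x_0}{\rho_{t+1}(1-d_0^-)}\Big)\Big(-\boldsymbol k_t^-(\boldsymbol s_t)\,\mathbb 1_{\{\rho_tx_t\le c\}}+\boldsymbol k_t^+(\boldsymbol s_t)\,\mathbb 1_{\{\rho_tx_t>c\}}\Big),\qquad c=\frac{x_{\rm tg}-\rho_0d_0^-x_0}{1-d_0^-},$$ is optimal for $\mathcal P^2_{\rm mv}(x_{\rm tg})$, with finite variance. With the Lagrange multiplier $\lambda^*=\dfrac{d_0^-(x_{\rm tg}-\rho_0x_0)}{1-d_0^-}$ it coincides with the rule $$\Big(r^0_{t+1}x_t-\frac{\rho_0x_0d_0^-+\lambda^*}{\rho_{t+1}d_0^-}\Big)\Big(-\boldsymbol k_t^-(\boldsymbol s_t)\,\mathbb 1_{\{\rho_tx_t\le\rho_0x_0+\lambda^*/d_0^-\}}+\boldsymbol k_t^+(\boldsymbol s_t)\,\mathbb 1_{\{\rho_tx_t>\rho_0x_0+\lambda^*/d_0^-\}}\Big),$$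 and it minimizes the Lagrangian $\mathrm{Var}[x_T]-2\lambda^*(\mathrm E[x_T]-x_{\rm tg})$ over all policies with square-integrable $x_T$. Its terminal wealth $x_T^*$ satisfies $\mathrm E[x_T^*]=x_{\rm tg}$ and $$\mathrm{Var}[x_T^*]=\frac{d_0^-(\mathrm E[x_T^*]-\rho_0x_0)^2}{1-d_0^-},$$ and the mean-variance efficient frontier, i.e. the set of all pairs $(\mathrm E[x_T],\mathrm{Var}[x_T])$ of policies with square-integrable $x_T$ that are not dominated by another such policy (mean at least as large and variance at most as large, one of them strictly), is $\{(m,v): m\ge\rho_0x_0,\ v=d_0^-(m-\rho_0x_0)^2/(1-d_0^-)\}$. -/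

import Mathlib

open MeasureTheory ProbabilityTheory
open scoped ENNReal

/-- Column vectors in `ℝⁿ`. -/
abbrev Vec (n : ℕ) : Type := EuclideanSpace ℝ (Fin n)

/-- The inner product `aᵀ b` of two vectors. -/
noncomputable def dotp {n : ℕ} (a b : Vec n) : ℝ := inner ℝ a b

/-- A market with one risk-free asset and `N` risky assets over `T` periods, driven by
`Ns`-dimensional observable state variables, together with cone constraints on the portfolio. -/
structure FactorMarket {Ω : Type*} [mΩ : MeasurableSpace Ω] (P : Measure Ω)
    [IsProbabilityMeasure P] (T N Ns Ne Nx : ℕ) where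
  /-- The information available at each time. -/
  info : Filtration ℕ mΩ
  info_zero : info 0 = ⊥
  /-- `riskFree t` is the deterministic gross risk-free return `r⁰ₜ` of the period ending at `t`. -/
  riskFree : ℕ → ℝ
  riskFree_pos : ∀ t, 1 ≤ t → t ≤ T → 0 < riskFree t
  /-- `r t` is the vector of excess returns of the period ending at time `t`. -/
  r : ℕ → Ω → Vec N
  /-- `s t` is the vector of state variables at time `t`. -/
  s : ℕ → Ω → Vec Ns
  /-- The noise of the excess returns. -/
  eps : ℕ → Ω → Vec Ne
  /-- The noise of the state variables. -/
  xi : ℕ → Ω → Vec Nx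
  /-- The return function. -/
  f : ℕ → Vec Ns → Vec Ne → Vec N
  /-- The state transition function. -/
  g : ℕ → Vec Ns → Vec Nx → Vec Ns
  r_meas : ∀ t, 1 ≤ t → t ≤ T → Measurable[info t] (r t)
  s_meas : ∀ t, t ≤ T → Measurable[info t] (s t)
  eps_meas : ∀ t, 1 ≤ t → t ≤ T → Measurable[info t] (eps t)
  xi_meas : ∀ t, 1 ≤ t → t ≤ T → Measurable[info t] (xi t)
  r_eq : ∀ t, 1 ≤ t → t ≤ T → ∀ ω, r t ω = f t (s t ω) (eps t ω)
  s_eq : ∀ t, 1 ≤ t → t ≤ T → ∀ ω, s t ω = g t (s (t - 1) ω) (xi t ω)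
  /-- The (deterministic) initial state. -/
  sInit : Vec Ns
  s_zero : ∀ ω, s 0 ω = sInit
  /-- Conditioning the next excess returns and the next state on all the information at time `t`
  is the same as conditioning them on the state `s t`. -/
  markov : ∀ t, t < T → ∀ B : Set (Vec N × Vec Ns), MeasurableSet B →
    P⟦(fun ω => (r (t + 1) ω, s (t + 1) ω)) ⁻¹' B | info t⟧
      =ᵐ[P] P⟦(fun ω => (r (t + 1) ω, s (t + 1) ω)) ⁻¹' B | MeasurableSpace.comap (s t) inferInstance⟧
  /-- Given the state, the excess returns have finite second moments. -/
  secondMoment : ∀ t, t < T → ∀ᵐ x ∂(P.map (s t)),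
    MemLp (fun p : Vec N × Vec Ns => p.1) 2
      (condDistrib (fun ω => (r (t + 1) ω, s (t + 1) ω)) (s t) P x)
  /-- Given the state, the excess returns are linearly independent: their conditional
  covariance matrix is positive definite. -/
  cov_posDef : ∀ t, t < T → ∀ᵐ x ∂(P.map (s t)),
    (Matrix.of fun i j : Fin N =>
      cov[fun p : Vec N × Vec Ns => p.1 i, fun p : Vec N × Vec Ns => p.1 j;
        condDistrib (fun ω => (r (t + 1) ω, s (t + 1) ω)) (s t) P x]).PosDef
  /-- `A t` is the set of portfolios allowed at time `t`: a cone, not necessarily convex. -/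
  A : ℕ → Set (Vec N)
  zero_mem_A : ∀ t, t < T → (0 : Vec N) ∈ A t
  smul_mem_A : ∀ t, t < T → ∀ c : ℝ, 0 < c → ∀ k ∈ A t, c • k ∈ A t

namespace FactorMarket

variable {Ω : Type*} [mΩ : MeasurableSpace Ω] {P : Measure Ω} [IsProbabilityMeasure P]
  {T N Ns Ne Nx : ℕ}

/-- The conditional law of `(r (t+1), s (t+1))` given the state `s t`. -/
noncomputable def condLaw (M : FactorMarket P T N Ns Ne Nx) (t : ℕ) :
    Kernel (Vec Ns) (Vec N × Vec Ns) :=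
  condDistrib (fun ω => (M.r (t + 1) ω, M.s (t + 1) ω)) (M.s t) P

/-- The accumulated risk-free return `ρₜ` from time `t` to time `T`. -/
def rho (M : FactorMarket P T N Ns Ne Nx) (t : ℕ) : ℝ :=
  ∏ k ∈ Finset.Ico t T, M.riskFree (k + 1)

/-- `E[(1 - rᵀk)² (dm(s') 1{rᵀk ≤ 1} + dp(s') 1{rᵀk > 1}) | s t = x]`, where `r` and `s'` are the
excess returns and the state at time `t + 1`. -/
noncomputable def costMinus (M : FactorMarket P T N Ns Ne Nx) (t : ℕ) (dm dp : Vec Ns → ℝ)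
    (x : Vec Ns) (k : Vec N) : ℝ :=
  ∫ p, (1 - dotp p.1 k) ^ 2 * (if dotp p.1 k ≤ 1 then dm p.2 else dp p.2) ∂(M.condLaw t x)

/-- `E[(1 + rᵀk)² (dm(s') 1{rᵀk ≤ -1} + dp(s') 1{rᵀk > -1}) | s t = x]`, where `r` and `s'` are the
excess returns and the state at time `t + 1`. -/
noncomputable def costPlus (M : FactorMarket P T N Ns Ne Nx) (t : ℕ) (dm dp : Vec Ns → ℝ)
    (x : Vec Ns) (k : Vec N) : ℝ :=
  ∫ p, (1 + dotp p.1 k) ^ 2 * (if dotp p.1 k ≤ -1 then dm p.2 else dp p.2) ∂(M.condLaw t x)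

/-- The pair `(d⁻, d⁺)` of functions of the state when `n` periods remain (at time `T - n`). -/
noncomputable def dPair (M : FactorMarket P T N Ns Ne Nx) : ℕ → (Vec Ns → ℝ) × (Vec Ns → ℝ)
  | 0 => (fun _ => 1, fun _ => 1)
  | n + 1 =>
    (fun x => ⨅ k : M.A (T - (n + 1)),
        M.costMinus (T - (n + 1)) (M.dPair n).1 (M.dPair n).2 x k,
      fun x => ⨅ k : M.A (T - (n + 1)),
        M.costPlus (T - (n + 1)) (M.dPair n).1 (M.dPair n).2 x k)

/-- The function `d⁻ₜ` of the state. -/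
noncomputable def dMinus (M : FactorMarket P T N Ns Ne Nx) (t : ℕ) : Vec Ns → ℝ :=
  (M.dPair (T - t)).1

/-- The function `d⁺ₜ` of the state. -/
noncomputable def dPlus (M : FactorMarket P T N Ns Ne Nx) (t : ℕ) : Vec Ns → ℝ :=
  (M.dPair (T - t)).2

theorem dMinus_terminal (M : FactorMarket P T N Ns Ne Nx) (x : Vec Ns) : M.dMinus T x = 1 := by
  simp [dMinus, dPair]

theorem dPlus_terminal (M : FactorMarket P T N Ns Ne Nx) (x : Vec Ns) : M.dPlus T x = 1 := by
  simp [dPlus, dPair]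

theorem dMinus_step (M : FactorMarket P T N Ns Ne Nx) {t : ℕ} (ht : t < T) (x : Vec Ns) :
    M.dMinus t x = ⨅ k : M.A t, M.costMinus t (M.dMinus (t + 1)) (M.dPlus (t + 1)) x k := by
  obtain ⟨n, rfl⟩ : ∃ n, T = t + (n + 1) := ⟨T - t - 1, by omega⟩
  have h1 : t + (n + 1) - t = n + 1 := by omega
  have h2 : t + (n + 1) - (t + 1) = n := by omega
  have h3 : t + (n + 1) - (n + 1) = t := by omega
  have key : ∀ u, u = t → (⨅ k : M.A u, M.costMinus u (M.dPair n).1 (M.dPair n).2 x k)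
      = ⨅ k : M.A t, M.costMinus t (M.dPair n).1 (M.dPair n).2 x k := by
    rintro u rfl
    rfl
  simp only [dMinus, dPlus, h1, h2, dPair]
  exact key _ h3

theorem dPlus_step (M : FactorMarket P T N Ns Ne Nx) {t : ℕ} (ht : t < T) (x : Vec Ns) :
    M.dPlus t x = ⨅ k : M.A t, M.costPlus t (M.dMinus (t + 1)) (M.dPlus (t + 1)) x k := by
  obtain ⟨n, rfl⟩ : ∃ n, T = t + (n + 1) := ⟨T - t - 1, by omega⟩
  have h1 : t + (n + 1) - t = n + 1 := by omega
  have h2 : t + (n + 1) - (t + 1) = n := by omega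
  have h3 : t + (n + 1) - (n + 1) = t := by omega
  have key : ∀ u, u = t → (⨅ k : M.A u, M.costPlus u (M.dPair n).1 (M.dPair n).2 x k)
      = ⨅ k : M.A t, M.costPlus t (M.dPair n).1 (M.dPair n).2 x k := by
    rintro u rfl
    rfl
  simp only [dMinus, dPlus, h1, h2, dPair]
  exact key _ h3

/-- `km t` and `kp t` are measurable selections of minimizers over the cone `A t` of the
optimization problems that define `d⁻ₜ` and `d⁺ₜ`. -/
structure AreMinimizers (M : FactorMarket P T N Ns Ne Nx) (km kp : ℕ → Vec Ns → Vec N) : Prop where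
  meas_minus : ∀ t, t < T → Measurable (km t)
  meas_plus : ∀ t, t < T → Measurable (kp t)
  mem_minus : ∀ t, t < T → ∀ x, km t x ∈ M.A t
  mem_plus : ∀ t, t < T → ∀ x, kp t x ∈ M.A t
  min_minus : ∀ t, t < T → ∀ᵐ x ∂(P.map (M.s t)),
    IsMinOn (M.costMinus t (M.dMinus (t + 1)) (M.dPlus (t + 1)) x) (M.A t) (km t x)
  min_plus : ∀ t, t < T → ∀ᵐ x ∂(P.map (M.s t)),
    IsMinOn (M.costPlus t (M.dMinus (t + 1)) (M.dPlus (t + 1)) x) (M.A t) (kp t x)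

/-- The wealth generated from the initial wealth `x₀` by the portfolio process `π`. -/
noncomputable def wealth (M : FactorMarket P T N Ns Ne Nx) (x₀ : ℝ) (π : ℕ → Ω → Vec N) :
    ℕ → Ω → ℝ
  | 0 => fun _ => x₀
  | t + 1 => fun ω => M.riskFree (t + 1) * M.wealth x₀ π t ω + dotp (M.r (t + 1) ω) (π t ω)

/-- Admissible policies: adapted to the information and confined to the cones. -/
def IsAdmissible (M : FactorMarket P T N Ns Ne Nx) (π : ℕ → Ω → Vec N) : Prop :=
  ∀ t, t < T → Measurable[M.info t] (π t) ∧ ∀ ω, π t ω ∈ M.A t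

/-- Feasible policies of the target-mean problem: admissible, with a terminal wealth whose mean
exists and equals the target `xtg`. -/
def IsFeasible (M : FactorMarket P T N Ns Ne Nx) (x₀ xtg : ℝ) (π : ℕ → Ω → Vec N) : Prop :=
  M.IsAdmissible π ∧ Integrable (M.wealth x₀ π T) P ∧ ∫ ω, M.wealth x₀ π T ω ∂P = xtg

/-- Optimal policies of the target-mean problem: feasible policies with finite variance of the
terminal wealth, minimal among all feasible policies (whose variance may be infinite). -/
def IsOptimal (M : FactorMarket P T N Ns Ne Nx) (x₀ xtg : ℝ) (π : ℕ → Ω → Vec N) : Prop :=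
  M.IsFeasible x₀ xtg π ∧ MemLp (M.wealth x₀ π T) 2 P ∧
    ∀ π', M.IsFeasible x₀ xtg π' → eVar[M.wealth x₀ π T; P] ≤ eVar[M.wealth x₀ π' T; P]

/-- The wealth process generated by the feedback rule `φ t x s` (time, wealth, state). -/
noncomputable def feedbackWealth (M : FactorMarket P T N Ns Ne Nx) (x₀ : ℝ)
    (φ : ℕ → ℝ → Vec Ns → Vec N) : ℕ → Ω → ℝ
  | 0 => fun _ => x₀
  | t + 1 => fun ω => M.riskFree (t + 1) * M.feedbackWealth x₀ φ t ω
      + dotp (M.r (t + 1) ω) (φ t (M.feedbackWealth x₀ φ t ω) (M.s t ω))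

/-- The portfolio process generated by the feedback rule `φ`. -/
noncomputable def feedbackPolicy (M : FactorMarket P T N Ns Ne Nx) (x₀ : ℝ)
    (φ : ℕ → ℝ → Vec Ns → Vec N) : ℕ → Ω → Vec N :=
  fun t ω => φ t (M.feedbackWealth x₀ φ t ω) (M.s t ω)

/-- The portfolio process of a feedback rule generates the wealth process of that rule. -/
theorem wealth_feedbackPolicy (M : FactorMarket P T N Ns Ne Nx) (x₀ : ℝ)
    (φ : ℕ → ℝ → Vec Ns → Vec N) (t : ℕ) (ω : Ω) :
    M.wealth x₀ (M.feedbackPolicy x₀ φ) t ω = M.feedbackWealth x₀ φ t ω := by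
  induction t with
  | zero => rfl
  | succ t ih => simp only [wealth, feedbackWealth, ih, feedbackPolicy]

/-- The optimal feedback rule of the mean-variance problem with trade-off parameter `lam`. -/
noncomputable def tradeoffRule (M : FactorMarket P T N Ns Ne Nx) (x₀ lam : ℝ)
    (km kp : ℕ → Vec Ns → Vec N) (t : ℕ) (x : ℝ) (s : Vec Ns) : Vec N :=
  let d := M.dMinus 0 M.sInit
  let y := M.riskFree (t + 1) * x - (M.rho 0 * x₀ * d + lam) / (M.rho (t + 1) * d)
  if M.rho t * x ≤ M.rho 0 * x₀ + lam / d then -(y • km t s) else y • kp t s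

/-- The optimal feedback rule of the target-mean problem. -/
noncomputable def targetRule (M : FactorMarket P T N Ns Ne Nx) (x₀ xtg : ℝ)
    (km kp : ℕ → Vec Ns → Vec N) (t : ℕ) (x : ℝ) (s : Vec Ns) : Vec N :=
  let d := M.dMinus 0 M.sInit
  let y := M.riskFree (t + 1) * x - (xtg - M.rho 0 * d * x₀) / (M.rho (t + 1) * (1 - d))
  if M.rho t * x ≤ (xtg - M.rho 0 * d * x₀) / (1 - d) then -(y • km t s) else y • kp t s

/-- The Lagrange multiplier of the constraint on the mean. -/
noncomputable def multiplier (M : FactorMarket P T N Ns Ne Nx) (x₀ xtg : ℝ) : ℝ :=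
  M.dMinus 0 M.sInit * (xtg - M.rho 0 * x₀) / (1 - M.dMinus 0 M.sInit)

/-- Admissible policies whose terminal wealth is square integrable. -/
def IsSquareAdmissible (M : FactorMarket P T N Ns Ne Nx) (x₀ : ℝ) (π : ℕ → Ω → Vec N) : Prop :=
  M.IsAdmissible π ∧ MemLp (M.wealth x₀ π T) 2 P

/-- The mean of the terminal wealth. -/
noncomputable def meanT (M : FactorMarket P T N Ns Ne Nx) (x₀ : ℝ) (π : ℕ → Ω → Vec N) : ℝ :=
  ∫ ω, M.wealth x₀ π T ω ∂P

/-- The variance of the terminal wealth. -/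
noncomputable def varT (M : FactorMarket P T N Ns Ne Nx) (x₀ : ℝ) (π : ℕ → Ω → Vec N) : ℝ :=
  Var[M.wealth x₀ π T; P]

/-- The mean-variance efficient frontier: the pairs (mean, variance) of the terminal wealth of the
policies that are not dominated by another policy. -/
def efficientFrontier (M : FactorMarket P T N Ns Ne Nx) (x₀ : ℝ) : Set (ℝ × ℝ) :=
  {p | ∃ π, M.IsSquareAdmissible x₀ π ∧ p = (M.meanT x₀ π, M.varT x₀ π) ∧
    ∀ π', M.IsSquareAdmissible x₀ π' → M.meanT x₀ π ≤ M.meanT x₀ π' →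
      M.varT x₀ π' ≤ M.varT x₀ π →
      M.meanT x₀ π' = M.meanT x₀ π ∧ M.varT x₀ π' = M.varT x₀ π}

end FactorMarket

/-! Fix a level `c` and put `z_t = ρ_t x_t - c`. Multiplying the wealth equation by `ρ_{t+1}` gives
`z_{t+1} = z_t + r_{t+1}ᵀ(ρ_{t+1} π_t)`, so the rescaled portfolio again ranges over the cone and
the risk-free rate has disappeared. Minimizing `E[z_T²]` is homogeneous of degree two under positive
scaling of gap and portfolio together. The minimal cost from gap `z` is therefore `d⁻ z²` for `z ≤
0` and `d⁺ z²` for `z ≥ 0`; two coefficients are needed because a cone need not be symmetric. The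
Markov property turns the one-period infima into a dynamic programming inequality for every policy
(`gapValue_le_lintegral`), with equality for the scaled minimizers (`lintegral_eq_gapValue`). Both
use integrals in `[0, ∞]`, so intermediate wealths need no integrability.

With `a = ρ_0 x_0`, `d = d_0⁻`, and `m`, `v` the mean and variance of a square-integrable terminal
wealth, this reads `d (c - a)² ≤ v + (m - c)²` for all `c ≥ a` (`dMinus_mul_sq_le`). Part (ii)
follows from this family of bounds. Optimizing over `c` gives `v ≥ d (m - a)² / (1 - d)` when `m ≥
a`. For the target rule the bound is an equality at its own `c`; a nonnegative function of `c`
vanishing there is stationary, which yields the mean without solving a recursion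
(`eq_of_quadratic_touches`).

For (i), `d_0⁻ = 1` forces `d_t⁻ = 1` along almost all states. Small multiples of a portfolio then
show that no allowed portfolio has positive conditional mean excess return. Integrable terminal
wealth thus has mean at most `ρ_0 x_0`, by a localized supermartingale argument
(`mul_setIntegral_wealth_le`); `d_0⁺ = 1` is the mirror image.

Minimizers exist on closed cones because a positive definite covariance makes the one-period cost
coercive; they are chosen measurably by a selection theorem. -/

/-! ### Signed quadratic functions -/

/-- The quadratic cost with weight `a` on the negative part and `b` on the positive part. -/
noncomputable def signedQuad (a b z : ℝ) : ℝ := a * (min z 0) ^ 2 + b * (max z 0) ^ 2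

theorem signedQuad_of_nonpos {a b z : ℝ} (h : z ≤ 0) : signedQuad a b z = a * z ^ 2 := by
  simp [signedQuad, h]

theorem signedQuad_of_nonneg {a b z : ℝ} (h : 0 ≤ z) : signedQuad a b z = b * z ^ 2 := by
  simp [signedQuad, h]

theorem signedQuad_one_one (z : ℝ) : signedQuad 1 1 z = z ^ 2 := by
  rcases le_total z 0 with h | h
  · simp [signedQuad_of_nonpos h]
  · simp [signedQuad_of_nonneg h]

theorem signedQuad_nonneg {a b : ℝ} (ha : 0 ≤ a) (hb : 0 ≤ b) (z : ℝ) : 0 ≤ signedQuad a b z := by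
  unfold signedQuad; positivity

theorem signedQuad_le_sq {a b : ℝ} (ha : a ≤ 1) (hb : b ≤ 1) (z : ℝ) :
    signedQuad a b z ≤ z ^ 2 := by
  rcases le_total z 0 with h | h
  · rw [signedQuad_of_nonpos h]; nlinarith [sq_nonneg z]
  · rw [signedQuad_of_nonneg h]; nlinarith [sq_nonneg z]

theorem signedQuad_mul {c : ℝ} (hc : 0 ≤ c) (a b z : ℝ) :
    signedQuad a b (c * z) = c ^ 2 * signedQuad a b z := by
  rcases le_total z 0 with h | h
  · rw [signedQuad_of_nonpos h, signedQuad_of_nonpos (mul_nonpos_of_nonneg_of_nonpos hc h)]; ring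
  · rw [signedQuad_of_nonneg h, signedQuad_of_nonneg (mul_nonneg hc h)]; ring

theorem eq_zero_of_signedQuad_eq_zero {a b z : ℝ} (ha : 0 < a) (hb : 0 < b)
    (h : signedQuad a b z = 0) : z = 0 := by
  rcases le_total z 0 with hz | hz
  · rw [signedQuad_of_nonpos hz] at h; simpa [ha.ne'] using h
  · rw [signedQuad_of_nonneg hz] at h; simpa [hb.ne'] using h

theorem continuous_signedQuad (a b : ℝ) : Continuous (signedQuad a b) := by
  unfold signedQuad; fun_prop

theorem continuous_dotp {n : ℕ} : Continuous (fun q : Vec n × Vec n => dotp q.1 q.2) := by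
  unfold dotp; fun_prop

theorem measurable_dotp {n : ℕ} : Measurable (fun q : Vec n × Vec n => dotp q.1 q.2) :=
  continuous_dotp.measurable

theorem abs_dotp_le {n : ℕ} (a b : Vec n) : |dotp a b| ≤ ‖a‖ * ‖b‖ := abs_real_inner_le_norm a b

theorem dotp_smul {n : ℕ} (a b : Vec n) (c : ℝ) : dotp a (c • b) = c * dotp a b := by
  simp [dotp, inner_smul_right]

theorem dotp_zero {n : ℕ} (a : Vec n) : dotp a 0 = 0 := by simp [dotp]

/-! ### One-period expected loss: homogeneity, continuity, coercivity -/

section Loss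

variable {N : ℕ} {Y : Type*} [MeasurableSpace Y]

/-- The expected signed quadratic cost of `τ + rᵀk` when `(r, y)` has law `μ` and the weights
depend on `y`. -/
noncomputable def quadLoss (μ : Measure (Vec N × Y)) (a b : Y → ℝ) (τ : ℝ) (k : Vec N) : ℝ :=
  ∫ p, signedQuad (a p.2) (b p.2) (τ + dotp p.1 k) ∂μ

/-- The returns are square integrable and the weights are measurable with values in `[0, 1]`. -/
structure IsLossData (μ : Measure (Vec N × Y)) (a b : Y → ℝ) : Prop where
  aemeasurable_a : AEMeasurable (fun p => a p.2) μ
  aemeasurable_b : AEMeasurable (fun p => b p.2) μ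
  a_nonneg : ∀ y, 0 ≤ a y
  b_nonneg : ∀ y, 0 ≤ b y
  a_le_one : ∀ y, a y ≤ 1
  b_le_one : ∀ y, b y ≤ 1
  memLp : MemLp (fun p : Vec N × Y => p.1) 2 μ

theorem memLp_dotp {μ : Measure (Vec N × Y)} (h : MemLp (fun p : Vec N × Y => p.1) 2 μ)
    (k : Vec N) : MemLp (fun p : Vec N × Y => dotp p.1 k) 2 μ := by
  refine (h.norm.const_mul ‖k‖).mono' ?_ ?_
  · exact (measurable_dotp.comp (measurable_fst.prodMk measurable_const)).aestronglyMeasurable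
  · refine Filter.Eventually.of_forall fun p => ?_
    rw [Real.norm_eq_abs, mul_comm]
    exact abs_dotp_le _ _

variable {μ : Measure (Vec N × Y)} {a b : Y → ℝ}

theorem aemeasurable_signedQuad (ha : AEMeasurable (fun p => a p.2) μ)
    (hb : AEMeasurable (fun p => b p.2) μ) (τ : ℝ) (k : Vec N) :
    AEMeasurable (fun p => signedQuad (a p.2) (b p.2) (τ + dotp p.1 k)) μ := by
  have h : AEMeasurable (fun p : Vec N × Y => τ + dotp p.1 k) μ :=
    (measurable_const.add
      (measurable_dotp.comp (measurable_fst.prodMk measurable_const))).aemeasurable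
  unfold signedQuad
  exact (ha.mul ((h.min aemeasurable_const).pow_const 2)).add
    (hb.mul ((h.max aemeasurable_const).pow_const 2))

theorem quadLoss_nonneg (ha : ∀ y, 0 ≤ a y) (hb : ∀ y, 0 ≤ b y) (τ : ℝ) (k : Vec N) :
    0 ≤ quadLoss μ a b τ k :=
  integral_nonneg fun _ => signedQuad_nonneg (ha _) (hb _) _

/-- Joint homogeneity in gap and portfolio reduces every gap to `τ = -1`, `0` or `1`, and reduces
coercivity to a bound on the unit sphere. -/
theorem quadLoss_mul {c : ℝ} (hc : 0 ≤ c) (τ : ℝ) (k : Vec N) :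
    quadLoss μ a b (c * τ) (c • k) = c ^ 2 * quadLoss μ a b τ k := by
  unfold quadLoss
  rw [← integral_const_mul]
  refine integral_congr_ae (Filter.Eventually.of_forall fun p => ?_)
  simp only
  rw [dotp_smul, ← mul_add, signedQuad_mul hc]

theorem quadLoss_congr {a' b' : Y → ℝ} (ha : ∀ᵐ p ∂μ, a p.2 = a' p.2)
    (hb : ∀ᵐ p ∂μ, b p.2 = b' p.2) (τ : ℝ) (k : Vec N) :
    quadLoss μ a b τ k = quadLoss μ a' b' τ k := by
  refine integral_congr_ae ?_
  filter_upwards [ha, hb] with p h1 h2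
  rw [h1, h2]

namespace IsLossData

theorem signedQuad_nonneg (h : IsLossData μ a b) (y : Y) (z : ℝ) :
    0 ≤ signedQuad (a y) (b y) z := _root_.signedQuad_nonneg (h.a_nonneg y) (h.b_nonneg y) z

variable [IsProbabilityMeasure μ]

theorem integrable (h : IsLossData μ a b) (τ : ℝ) (k : Vec N) :
    Integrable (fun p => signedQuad (a p.2) (b p.2) (τ + dotp p.1 k)) μ := by
  have h2 : MemLp (fun p : Vec N × Y => τ + dotp p.1 k) 2 μ :=
    (memLp_const τ).add (memLp_dotp h.memLp k)
  refine h2.integrable_sq.mono'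
    (aemeasurable_signedQuad h.aemeasurable_a h.aemeasurable_b τ k).aestronglyMeasurable ?_
  refine Filter.Eventually.of_forall fun p => ?_
  rw [Real.norm_of_nonneg (h.signedQuad_nonneg _ _)]
  exact signedQuad_le_sq (h.a_le_one _) (h.b_le_one _) _

theorem ofReal_quadLoss (h : IsLossData μ a b) (τ : ℝ) (k : Vec N) :
    ENNReal.ofReal (quadLoss μ a b τ k)
      = ∫⁻ p, ENNReal.ofReal (signedQuad (a p.2) (b p.2) (τ + dotp p.1 k)) ∂μ :=
  ofReal_integral_eq_lintegral_ofReal (h.integrable τ k)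
    (Filter.Eventually.of_forall fun _ => h.signedQuad_nonneg _ _)

theorem continuous_quadLoss (h : IsLossData μ a b) :
    Continuous (fun q : ℝ × Vec N => quadLoss μ a b q.1 q.2) := by
  rw [continuous_iff_continuousAt]
  intro q₀
  -- `R` bounds both `|τ|` and `‖k‖` near `q₀`, so `((1 + ‖r‖) R)²` dominates the integrand there.
  set R := ‖q₀‖ + 1
  have hint : Integrable (fun p : Vec N × Y => ((1 + ‖p.1‖) * R) ^ 2) μ :=
    ((((memLp_const (1 : ℝ)).add h.memLp.norm).mul_const R)).integrable_sq
  refine continuousAt_of_dominated (bound := fun p : Vec N × Y => ((1 + ‖p.1‖) * R) ^ 2)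
    ?_ ?_ hint ?_
  · exact Filter.Eventually.of_forall fun q =>
      (aemeasurable_signedQuad h.aemeasurable_a h.aemeasurable_b _ _).aestronglyMeasurable
  · have hq : ∀ᶠ q in nhds q₀, ‖q‖ < R :=
      continuous_norm.continuousAt.eventually_lt continuousAt_const (by simp [R])
    filter_upwards [hq] with q hq
    refine Filter.Eventually.of_forall fun p => ?_
    rw [Real.norm_of_nonneg (h.signedQuad_nonneg _ _)]
    refine (signedQuad_le_sq (h.a_le_one _) (h.b_le_one _) _).trans ?_
    refine sq_le_sq' ?_ ?_ <;>
    · have h1 : |q.1| ≤ R := (norm_fst_le q).trans hq.le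
      have h2 : ‖q.2‖ ≤ R := (norm_snd_le q).trans hq.le
      have h3 := abs_dotp_le p.1 q.2
      have h4 : ‖p.1‖ * ‖q.2‖ ≤ ‖p.1‖ * R := by gcongr
      have h5 := abs_le.1 h1
      have h6 := abs_le.1 (h3.trans h4)
      nlinarith [h5.1, h5.2, h6.1, h6.2]
  · refine Filter.Eventually.of_forall fun p => Continuous.continuousAt ?_
    refine (continuous_signedQuad _ _).comp (continuous_fst.add ?_)
    exact continuous_dotp.comp (continuous_const.prodMk continuous_snd)

/-- Zero loss with positive weights makes `rᵀk` almost surely equal to the constant `-τ`. Its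
variance `kᵀ Cov k` then vanishes, so `k = 0` by definiteness, and finally `τ = 0`. -/
theorem eq_zero_of_quadLoss_eq_zero (h : IsLossData μ a b) (ha : ∀ᵐ p ∂μ, 0 < a p.2)
    (hb : ∀ᵐ p ∂μ, 0 < b p.2)
    (hcov : (Matrix.of fun i j : Fin N =>
      cov[fun p : Vec N × Y => p.1 i, fun p : Vec N × Y => p.1 j; μ]).PosDef)
    {τ : ℝ} {k : Vec N} (h0 : quadLoss μ a b τ k = 0) : τ = 0 ∧ k = 0 := by
  have hae : ∀ᵐ p ∂μ, τ + dotp p.1 k = 0 := by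
    have := (integral_eq_zero_iff_of_nonneg (fun p => h.signedQuad_nonneg _ _)
      (h.integrable τ k)).1 h0
    filter_upwards [this, ha, hb] with p hp h1 h2
    exact eq_zero_of_signedQuad_eq_zero h1 h2 hp
  have hk : k = 0 := by
    by_contra hk
    have hk' : (WithLp.ofLp k) ≠ 0 := fun h' => hk (by ext i; simpa using congrFun h' i)
    have hpos := hcov.dotProduct_mulVec_pos hk'
    have hcoord : ∀ i, MemLp (fun p : Vec N × Y => p.1 i) 2 μ := fun i => by
      refine h.memLp.norm.mono' ?_ (Filter.Eventually.of_forall fun p => ?_)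
      · exact (((EuclideanSpace.proj (𝕜 := ℝ) i).continuous.measurable).comp
          measurable_fst).aestronglyMeasurable
      · exact PiLp.norm_apply_le p.1 i
    have hvar : cov[fun p : Vec N × Y => ∑ i, k i * p.1 i,
        fun p : Vec N × Y => ∑ i, k i * p.1 i; μ] = 0 := by
      have hc : (fun p : Vec N × Y => ∑ i, k i * p.1 i) =ᵐ[μ] fun _ => -τ := by
        filter_upwards [hae] with p hp
        have : dotp p.1 k = ∑ i, k i * p.1 i := by
          simp [dotp, PiLp.inner_apply]
        linarith
      rw [covariance_self (aemeasurable_const.congr hc.symm), variance_congr hc,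
        ← covariance_self aemeasurable_const, covariance_const_left]
    rw [covariance_fun_sum_fun_sum (fun i => (hcoord i).const_mul _)
      (fun i => (hcoord i).const_mul _)] at hvar
    simp only [covariance_const_mul_left, covariance_const_mul_right] at hvar
    refine hpos.ne' ?_
    rw [← hvar]
    simp only [dotProduct, Matrix.mulVec, Matrix.of_apply, Pi.star_apply, star_trivial,
      Finset.mul_sum]
    refine Finset.sum_congr rfl fun i _ => Finset.sum_congr rfl fun j _ => ?_
    ring
  refine ⟨?_, hk⟩
  obtain ⟨p, hp⟩ := hae.exists
  simpa [hk, dotp_zero] using hp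

/-- The loss is continuous and strictly positive on the compact unit sphere of pairs `(τ, k)`; its
minimum there serves as `η`, and homogeneity extends the bound to all pairs. -/
theorem exists_coercive (h : IsLossData μ a b) (ha : ∀ᵐ p ∂μ, 0 < a p.2)
    (hb : ∀ᵐ p ∂μ, 0 < b p.2)
    (hcov : (Matrix.of fun i j : Fin N =>
      cov[fun p : Vec N × Y => p.1 i, fun p : Vec N × Y => p.1 j; μ]).PosDef) :
    ∃ η > 0, ∀ (τ : ℝ) (k : Vec N), η * ‖k‖ ^ 2 ≤ quadLoss μ a b τ k := by
  obtain ⟨q₀, hq₀, hmin⟩ := (isCompact_sphere (0 : ℝ × Vec N) 1).exists_isMinOn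
    ⟨(1, 0), by simp [Prod.norm_def]⟩ h.continuous_quadLoss.continuousOn
  have hne : quadLoss μ a b q₀.1 q₀.2 ≠ 0 := fun h0 => by
    obtain ⟨h1, h2⟩ := h.eq_zero_of_quadLoss_eq_zero ha hb hcov h0
    have : q₀ = 0 := Prod.ext h1 h2
    simp [this] at hq₀
  refine ⟨_, (quadLoss_nonneg h.a_nonneg h.b_nonneg _ _).lt_of_ne hne.symm, fun τ k => ?_⟩
  set q : ℝ × Vec N := (τ, k)
  have hkq : ‖k‖ ≤ ‖q‖ := norm_snd_le q
  rcases eq_or_ne q 0 with hq | hq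
  · have hk : ‖k‖ = 0 := by
      have : ‖q‖ = 0 := by simp [hq]
      exact le_antisymm (this ▸ hkq) (norm_nonneg k)
    rw [hk]
    simpa using quadLoss_nonneg h.a_nonneg h.b_nonneg τ k
  · have hpos : 0 < ‖q‖ := norm_pos_iff.2 hq
    have hmem : ‖q‖⁻¹ • q ∈ Metric.sphere (0 : ℝ × Vec N) 1 := by
      simp [norm_smul, hpos.ne']
    have h1 : quadLoss μ a b q₀.1 q₀.2 ≤ quadLoss μ a b (‖q‖⁻¹ * τ) (‖q‖⁻¹ • k) := hmin hmem
    rw [quadLoss_mul (inv_nonneg.2 hpos.le)] at h1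
    have h2 : quadLoss μ a b q₀.1 q₀.2 * ‖q‖ ^ 2 ≤ quadLoss μ a b τ k := by
      calc _ ≤ (‖q‖⁻¹ ^ 2 * quadLoss μ a b τ k) * ‖q‖ ^ 2 := by gcongr
        _ = quadLoss μ a b τ k := by field_simp
    refine le_trans ?_ h2
    have := quadLoss_nonneg (μ := μ) h.a_nonneg h.b_nonneg q₀.1 q₀.2
    gcongr

theorem exists_isMinOn (h : IsLossData μ a b) (ha : ∀ᵐ p ∂μ, 0 < a p.2)
    (hb : ∀ᵐ p ∂μ, 0 < b p.2)
    (hcov : (Matrix.of fun i j : Fin N =>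
      cov[fun p : Vec N × Y => p.1 i, fun p : Vec N × Y => p.1 j; μ]).PosDef)
    (τ : ℝ) {A : Set (Vec N)} (hA : IsClosed A) (hne : A.Nonempty) :
    ∃ k ∈ A, IsMinOn (quadLoss μ a b τ) A k := by
  obtain ⟨k₀, hk₀⟩ := hne
  obtain ⟨η, hη, hle⟩ := h.exists_coercive ha hb hcov
  have hcont : Continuous (quadLoss μ a b τ) :=
    h.continuous_quadLoss.comp (continuous_const.prodMk continuous_id)
  refine hcont.continuousOn.exists_isMinOn' hA hk₀ (Filter.Eventually.filter_mono inf_le_left ?_)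
  have htend : Filter.Tendsto (fun k : Vec N => η * ‖k‖ ^ 2) (Filter.cocompact _) Filter.atTop :=
    Filter.Tendsto.const_mul_atTop hη
      ((Filter.tendsto_pow_atTop two_ne_zero).comp (tendsto_norm_cocompact_atTop))
  filter_upwards [htend.eventually_ge_atTop (quadLoss μ a b τ k₀)] with k hk
  exact hk.trans (hle τ k)

end IsLossData

end Loss

/-! ### Measurable selection of minimizers -/

section Selection

open Filter Topology

variable {X E : Type*} [MeasurableSpace X] [MetricSpace E] {f : X → E → ℝ}

/-- On a compact set the minimum is attained, so it is at most `c x` exactly when, for every `m`,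
some point of a countable dense subset has value below `c x + 1 / (m + 1)`. -/
theorem measurableSet_exists_mem_le {K : Set E} (hK : IsCompact K)
    (hfm : ∀ k, Measurable fun x => f x k) (hfc : ∀ x, Continuous (f x)) {c : X → ℝ}
    (hc : Measurable c) : MeasurableSet {x | ∃ k ∈ K, f x k ≤ c x} := by
  rcases K.eq_empty_or_nonempty with rfl | hne
  · simp
  have : Nonempty K := hne.to_subtype
  have : CompactSpace K := isCompact_iff_compactSpace.1 hK
  let q := TopologicalSpace.denseSeq K
  have heq : {x | ∃ k ∈ K, f x k ≤ c x}
      = ⋂ m : ℕ, ⋃ n : ℕ, {x | f x (q n) < c x + 1 / ((m : ℝ) + 1)} := by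
    ext x
    simp only [Set.mem_ofPred_eq, Set.mem_iInter, Set.mem_iUnion]
    constructor
    · rintro ⟨k, hk, hle⟩ m
      have hopen : IsOpen {y : K | f x y < c x + 1 / ((m : ℝ) + 1)} :=
        isOpen_lt ((hfc x).comp continuous_subtype_val) continuous_const
      obtain ⟨n, hn⟩ := (TopologicalSpace.denseRange_denseSeq K).exists_mem_open hopen
        ⟨⟨k, hk⟩, by
          have : 0 < 1 / ((m : ℝ) + 1) := Nat.one_div_pos_of_nat
          simp only [Set.mem_ofPred_eq]; linarith⟩
      exact ⟨n, hn⟩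
    · intro h
      obtain ⟨k, hk, hmin⟩ := hK.exists_isMinOn hne (hfc x).continuousOn
      refine ⟨k, hk, le_of_forall_pos_lt_add fun ε hε => ?_⟩
      obtain ⟨m, hm⟩ := exists_nat_one_div_lt hε
      obtain ⟨n, hn⟩ := h m
      have : f x k ≤ f x (q n) := hmin (q n).2
      linarith
  rw [heq]
  exact MeasurableSet.iInter fun m => MeasurableSet.iUnion fun n =>
    measurableSet_lt (hfm _) (hc.add_const _)

/-- The minimizer `k` itself need not be measurable: by continuity the minimal value is an infimum
over a countable dense subset of `A`. -/
theorem measurable_of_isMinOn [SecondCountableTopology E] {A : Set E}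
    (hfm : ∀ k, Measurable fun x => f x k)
    (hfc : ∀ x, Continuous (f x)) {k : X → E} (hk : ∀ x, k x ∈ A)
    (hmin : ∀ x, IsMinOn (f x) A (k x)) : Measurable fun x => f x (k x) := by
  rcases isEmpty_or_nonempty X with hX | ⟨⟨x₀⟩⟩
  · exact measurable_of_empty _
  have : Nonempty A := ⟨⟨k x₀, hk x₀⟩⟩
  let q := TopologicalSpace.denseSeq A
  refine measurable_of_Iio fun r => ?_
  have heq : (fun x => f x (k x)) ⁻¹' Set.Iio r = ⋃ n : ℕ, {x | f x (q n) < r} := by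
    ext x
    simp only [Set.mem_preimage, Set.mem_Iio, Set.mem_iUnion, Set.mem_ofPred_eq]
    constructor
    · intro h
      have hopen : IsOpen {y : A | f x y < r} :=
        isOpen_lt ((hfc x).comp continuous_subtype_val) continuous_const
      exact (TopologicalSpace.denseRange_denseSeq A).exists_mem_open hopen ⟨⟨k x, hk x⟩, h⟩
    · rintro ⟨n, hn⟩
      exact lt_of_le_of_lt (hmin x (q n).2) hn
  rw [heq]
  exact MeasurableSet.iUnion fun n => measurableSet_lt (hfm _) measurable_const

/-- A closed-valued map whose distance functions are measurable has a measurable selection. -/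
theorem exists_measurable_selection [CompleteSpace E] [SecondCountableTopology E]
    [MeasurableSpace E] [BorelSpace E] [Nonempty E] {C : X → Set E} (hC : ∀ x, IsClosed (C x))
    (hne : ∀ x, (C x).Nonempty) (hm : ∀ p, Measurable fun x => Metric.infDist p (C x)) :
    ∃ u : X → E, Measurable u ∧ ∀ x, u x ∈ C x := by
  classical
  let q := TopologicalSpace.denseSeq E
  have near : ∀ (x : X) (c : E) (ε : ℝ), 0 < ε → ∃ n, dist (q n) c < ε := fun x c ε hε => by
    obtain ⟨n, hn⟩ := (TopologicalSpace.denseRange_denseSeq E).exists_mem_open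
      (Metric.isOpen_ball (x := c) (ε := ε)) ⟨c, by simpa using hε⟩
    exact ⟨n, hn⟩
  -- Kuratowski–Ryll-Nardzewski scheme: the `j`-th approximation is measurable and within `2⁻ʲ` of
  -- `C x`. Taking the first suitable point of a dense sequence keeps it measurable, and steps of
  -- size at most `2 · 2⁻ʲ` make the approximations Cauchy.
  let Q : ℕ → (X → E) → Prop := fun j u =>
    Measurable u ∧ ∀ x, Metric.infDist (u x) (C x) < (1 / 2) ^ j
  have start : ∃ u, Q 0 u := by
    have hex : ∀ x, ∃ n, Metric.infDist (q n) (C x) < (1 / 2) ^ 0 := fun x => by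
      obtain ⟨c, hc⟩ := hne x
      obtain ⟨n, hn⟩ := near x c 1 one_pos
      exact ⟨n, lt_of_le_of_lt (Metric.infDist_le_dist_of_mem hc) (by simpa using hn)⟩
    refine ⟨fun x => q (Nat.find (hex x)), ?_, fun x => Nat.find_spec (hex x)⟩
    exact Measurable.find (f := fun n _ => q n) (fun n => measurable_const)
      (fun n => measurableSet_lt (hm _) measurable_const) hex
  have next : ∀ j u, Q j u → ∃ u', Q (j + 1) u' ∧ ∀ x, dist (u x) (u' x) ≤ 2 * (1 / 2) ^ j := by
    rintro j u ⟨hu, hd⟩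
    have hex : ∀ x, ∃ n, Metric.infDist (q n) (C x) < (1 / 2) ^ (j + 1)
        ∧ dist (u x) (q n) < 2 * (1 / 2) ^ j := fun x => by
      obtain ⟨c, hc, hcd⟩ := (Metric.infDist_lt_iff (hne x)).1 (hd x)
      obtain ⟨n, hn⟩ := near x c ((1 / 2) ^ (j + 1)) (by positivity)
      refine ⟨n, lt_of_le_of_lt (Metric.infDist_le_dist_of_mem hc) hn, ?_⟩
      have h1 := dist_triangle_right (u x) (q n) c
      have h2 : (1 / 2 : ℝ) ^ (j + 1) ≤ (1 / 2) ^ j := by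
        rw [pow_succ]; nlinarith [pow_pos (show (0 : ℝ) < 1 / 2 by norm_num) j]
      linarith
    refine ⟨fun x => q (Nat.find (hex x)), ⟨?_, fun x => (Nat.find_spec (hex x)).1⟩,
      fun x => (Nat.find_spec (hex x)).2.le⟩
    refine Measurable.find (f := fun n _ => q n) (fun n => measurable_const) (fun n => ?_) hex
    exact (measurableSet_lt (hm _) measurable_const).inter
      (measurableSet_lt (hu.dist measurable_const) measurable_const)
  choose next hQ hdist using next
  obtain ⟨u₀, hu₀⟩ := start
  let U : (j : ℕ) → {u // Q j u} := fun j =>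
    Nat.rec ⟨u₀, hu₀⟩ (fun j u => ⟨next j u.1 u.2, hQ j u.1 u.2⟩) j
  have hcau : ∀ x, CauchySeq fun j => (U j).1 x := fun x =>
    cauchySeq_of_le_geometric (1 / 2) 2 (by norm_num) fun j => hdist j (U j).1 (U j).2 x
  choose u hu using fun x => cauchySeq_tendsto_of_complete (hcau x)
  refine ⟨u, measurable_of_tendsto_metrizable (fun j => (U j).2.1) (tendsto_pi_nhds.2 hu),
    fun x => ?_⟩
  rw [(hC x).mem_iff_infDist_zero (hne x)]
  refine le_antisymm ?_ Metric.infDist_nonneg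
  refine le_of_tendsto_of_tendsto
    ((Metric.continuous_infDist_pt (C x)).continuousAt.tendsto.comp (hu x))
    (tendsto_pow_atTop_nhds_zero_of_lt_one (by norm_num) (by norm_num : (1 / 2 : ℝ) < 1)) ?_
  exact Eventually.of_forall fun j => ((U j).2.2 x).le

/-- Minimizers of a Carathéodory function over a closed set can be selected measurably. -/
theorem exists_measurable_isMinOn [ProperSpace E] [MeasurableSpace E] [BorelSpace E]
    {A : Set E} (hA : IsClosed A) (hfm : ∀ k, Measurable fun x => f x k)
    (hfc : ∀ x, Continuous (f x)) (hne : A.Nonempty) (hex : ∀ x, ∃ k ∈ A, IsMinOn (f x) A k) :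
    ∃ u : X → E, Measurable u ∧ ∀ x, u x ∈ A ∧ IsMinOn (f x) A (u x) := by
  have : Nonempty E := ⟨hne.some⟩
  choose k₀ hk₀ hmin₀ using hex
  have hv := measurable_of_isMinOn hfm hfc hk₀ hmin₀
  -- The argmin set is a sublevel set at the minimal value `f x (k₀ x)`, which is measurable in `x`
  -- although `k₀` is an arbitrary choice.
  have hCeq : ∀ x, {k | k ∈ A ∧ IsMinOn (f x) A k} = A ∩ {k | f x k ≤ f x (k₀ x)} := fun x => by
    ext k
    refine and_congr_right fun hk => ⟨fun h => h (hk₀ x), fun h =>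
      isMinOn_iff.2 fun k' hk' => le_trans h (isMinOn_iff.1 (hmin₀ x) k' hk')⟩
  have hCcl : ∀ x, IsClosed {k | k ∈ A ∧ IsMinOn (f x) A k} := fun x => by
    rw [hCeq]
    exact hA.inter (isClosed_le (hfc x) continuous_const)
  have hCne : ∀ x, {k | k ∈ A ∧ IsMinOn (f x) A k}.Nonempty := fun x => ⟨k₀ x, hk₀ x, hmin₀ x⟩
  refine exists_measurable_selection hCcl hCne fun p => measurable_of_Iic fun r => ?_
  -- In a proper space the distance to a nonempty closed set is attained, so the event only asks for
  -- a minimizer in the compact set `A ∩ closedBall p r`.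
  have heq : (fun x => Metric.infDist p {k | k ∈ A ∧ IsMinOn (f x) A k}) ⁻¹' Set.Iic r
      = {x | ∃ k ∈ A ∩ Metric.closedBall p r, f x k ≤ f x (k₀ x)} := by
    ext x
    simp only [Set.mem_preimage, Set.mem_Iic, Set.mem_ofPred_eq]
    constructor
    · intro h
      obtain ⟨k, hk, hd⟩ := (hCcl x).exists_infDist_eq_dist (hCne x) p
      refine ⟨k, ⟨hk.1, ?_⟩, hk.2 (hk₀ x)⟩
      rw [Metric.mem_closedBall, dist_comm, ← hd]
      exact h
    · rintro ⟨k, ⟨hkA, hkr⟩, hle⟩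
      have hk : k ∈ {k | k ∈ A ∧ IsMinOn (f x) A k} := by
        rw [hCeq]
        exact ⟨hkA, hle⟩
      refine (Metric.infDist_le_dist_of_mem hk).trans ?_
      rwa [dist_comm]
  rw [heq]
  exact measurableSet_exists_mem_le ((isCompact_closedBall p r).inter_left hA) hfm hfc hv

end Selection

/-! ### Conditional laws along the state process, and bounds on `d⁻` and `d⁺` -/

theorem quadLoss_zero_le_one {N : ℕ} {Y : Type*} [MeasurableSpace Y] {μ : Measure (Vec N × Y)}
    [IsProbabilityMeasure μ] {a b : Y → ℝ} (ha0 : ∀ y, 0 ≤ a y) (hb0 : ∀ y, 0 ≤ b y)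
    (ha : ∀ y, a y ≤ 1) (hb : ∀ y, b y ≤ 1) {τ : ℝ} (hτ : τ ^ 2 = 1) :
    quadLoss μ a b τ 0 ≤ 1 := by
  unfold quadLoss
  refine (integral_mono_of_nonneg (g := fun _ => (1 : ℝ))
    (Filter.Eventually.of_forall fun p => signedQuad_nonneg (ha0 _) (hb0 _) _)
    (integrable_const 1) (Filter.Eventually.of_forall fun p => ?_)).trans (by simp)
  simpa [dotp_zero, hτ] using signedQuad_le_sq (ha p.2) (hb p.2) (τ + dotp p.1 0)

theorem bddBelow_quadLoss {N : ℕ} {A : Set (Vec N)} {Y : Type*} [MeasurableSpace Y]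
    (μ : Measure (Vec N × Y)) {a b : Y → ℝ}
    (ha : ∀ y, 0 ≤ a y) (hb : ∀ y, 0 ≤ b y) (τ : ℝ) :
    BddBelow (Set.range fun k : A => quadLoss μ a b τ k) :=
  ⟨0, by rintro _ ⟨k, rfl⟩; exact quadLoss_nonneg ha hb _ _⟩

namespace FactorMarket

variable {Ω : Type*} [mΩ : MeasurableSpace Ω] {P : Measure Ω} [IsProbabilityMeasure P]
  {T N Ns Ne Nx : ℕ} (M : FactorMarket P T N Ns Ne Nx)

instance (t : ℕ) : IsMarkovKernel (M.condLaw t) := by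
  unfold condLaw; infer_instance

/-- The excess returns and the state of the next period. -/
def nextObs (t : ℕ) (ω : Ω) : Vec N × Vec Ns := (M.r (t + 1) ω, M.s (t + 1) ω)

theorem measurable_s {t : ℕ} (ht : t ≤ T) : Measurable (M.s t) :=
  (M.s_meas t ht).mono (M.info.le t) le_rfl

theorem measurable_r {t : ℕ} (h1 : 1 ≤ t) (ht : t ≤ T) : Measurable (M.r t) :=
  (M.r_meas t h1 ht).mono (M.info.le t) le_rfl

theorem measurable_nextObs {t : ℕ} (ht : t < T) : Measurable (M.nextObs t) :=
  (M.measurable_r (by omega) (by omega)).prodMk (M.measurable_s (by omega))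

/-- The conditional law of the next observation given the current information is `condLaw`. -/
theorem compProd_condLaw {t : ℕ} (ht : t < T) {β : Type*} [MeasurableSpace β] {U : Ω → β}
    (hU : Measurable[M.info t] U) :
    (P.map fun ω => (M.s t ω, U ω)) ⊗ₘ (M.condLaw t).prodMkRight β
      = P.map fun ω => ((M.s t ω, U ω), M.nextObs t ω) := by
  have hW' : Measurable[M.info t] fun ω => (M.s t ω, U ω) := (M.s_meas t ht.le).prodMk hU
  have hW : Measurable fun ω => (M.s t ω, U ω) := hW'.mono (M.info.le t) le_rfl
  have hY := M.measurable_nextObs ht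
  have : IsProbabilityMeasure (P.map fun ω => (M.s t ω, U ω)) :=
    Measure.isProbabilityMeasure_map hW.aemeasurable
  refine Measure.ext_prod fun {S B} hS hB => ?_
  rw [Measure.compProd_apply_prod hS hB, setLIntegral_map hS
    (((M.condLaw t).prodMkRight β).measurable_coe hB) hW,
    Measure.map_apply (hW.prodMk hY) (hS.prod hB)]
  simp only [Kernel.prodMkRight_apply]
  set G := (fun ω => (M.s t ω, U ω)) ⁻¹' S
  have hG' : MeasurableSet[M.info t] G := hW' hS
  have hG : MeasurableSet G := hW hS
  have hpre : (fun ω => ((M.s t ω, U ω), M.nextObs t ω)) ⁻¹' S ×ˢ B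
      = M.nextObs t ⁻¹' B ∩ G := by
    ext ω; simp [G, and_comm]
  -- The Markov assumption enters here: the kernel, built by conditioning on the state, also
  -- represents conditioning on all of `info t`.
  have hae : (fun ω => (M.condLaw t (M.s t ω)).real B)
      =ᵐ[P] P⟦M.nextObs t ⁻¹' B | M.info t⟧ :=
    (condDistrib_ae_eq_condExp (M.measurable_s ht.le) hY hB).trans (M.markov t ht B hB).symm
  have hint : Integrable ((M.nextObs t ⁻¹' B).indicator fun _ => (1 : ℝ)) P :=
    (integrable_const 1).indicator (hY hB)
  have hreal : ∫ ω in G, (M.condLaw t (M.s t ω)).real B ∂P = P.real (M.nextObs t ⁻¹' B ∩ G) := by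
    rw [setIntegral_congr_ae hG (hae.mono fun ω h _ => h), setIntegral_condExp _ hint hG',
      integral_indicator (hY hB), Measure.restrict_restrict (hY hB)]
    simp
  have hmeas : Measurable fun ω => M.condLaw t (M.s t ω) B :=
    ((M.condLaw t).measurable_coe hB).comp (M.measurable_s ht.le)
  rw [hpre, ← ofReal_measureReal (μ := P), ← hreal]
  simp only [Measure.real]
  rw [integral_toReal hmeas.aemeasurable (Filter.Eventually.of_forall fun _ => measure_lt_top _ _),
    ENNReal.ofReal_toReal]
  refine (lt_of_le_of_lt (lintegral_mono (g := fun _ => 1) fun _ => prob_le_one) ?_).ne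
  simp

theorem lintegral_nextObs {t : ℕ} (ht : t < T) {β : Type*} [MeasurableSpace β] {U : Ω → β}
    (hU : Measurable[M.info t] U) {F : (Vec Ns × β) × (Vec N × Vec Ns) → ℝ≥0∞}
    (hF : Measurable F) :
    ∫⁻ ω, F ((M.s t ω, U ω), M.nextObs t ω) ∂P
      = ∫⁻ ω, ∫⁻ p, F ((M.s t ω, U ω), p) ∂(M.condLaw t (M.s t ω)) ∂P := by
  have hW : Measurable fun ω => (M.s t ω, U ω) :=
    ((M.s_meas t ht.le).prodMk hU).mono (M.info.le t) le_rfl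
  have hY := M.measurable_nextObs ht
  have : IsProbabilityMeasure (P.map fun ω => (M.s t ω, U ω)) :=
    Measure.isProbabilityMeasure_map hW.aemeasurable
  rw [← lintegral_map hF (hW.prodMk hY), ← M.compProd_condLaw ht hU,
    Measure.lintegral_compProd hF, lintegral_map ?_ hW]
  · simp only [Kernel.prodMkRight_apply]
  · exact hF.lintegral_kernel_prod_right'

/-- By disintegration, a null set for the law of the next state is null under the conditional law at
almost every current state. This transports almost sure facts about `d_{t+1}` into the one-period
problem. -/
theorem ae_condLaw_of_ae {t : ℕ} (ht : t < T) {q : Vec Ns → Prop}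
    (hq : ∀ᵐ y ∂(P.map (M.s (t + 1))), q y) :
    ∀ᵐ x ∂(P.map (M.s t)), ∀ᵐ p ∂(M.condLaw t x), q p.2 := by
  have hs := M.measurable_s ht.le
  have : IsProbabilityMeasure (P.map (M.s t)) := Measure.isProbabilityMeasure_map hs.aemeasurable
  refine Measure.ae_ae_of_ae_compProd (p := fun z : Vec Ns × (Vec N × Vec Ns) => q z.2.2) ?_
  have heq : P.map (M.s t) ⊗ₘ M.condLaw t = P.map fun ω => (M.s t ω, M.nextObs t ω) :=
    compProd_map_condDistrib (M.measurable_nextObs ht).aemeasurable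
  rw [heq]
  obtain ⟨S, hS, hSm, hSq⟩ := hq.exists_measurable_mem
  have h1 : ∀ᵐ ω ∂P, M.s (t + 1) ω ∈ S :=
    ae_of_ae_map (M.measurable_s (by omega)).aemeasurable hS
  have h2 : ∀ᵐ z ∂(P.map fun ω => (M.s t ω, M.nextObs t ω)), z.2.2 ∈ S :=
    (ae_map_iff (hs.prodMk (M.measurable_nextObs ht)).aemeasurable
      (hSm.preimage (measurable_snd.comp measurable_snd))).2 h1
  filter_upwards [h2] with z hz using hSq _ hz

theorem map_s_zero : P.map (M.s 0) = Measure.dirac M.sInit := by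
  have : M.s 0 = fun _ => M.sInit := funext M.s_zero
  rw [this, Measure.map_const]
  simp

theorem rho_pos (t : ℕ) : 0 < M.rho t := by
  refine Finset.prod_pos fun k hk => ?_
  rw [Finset.mem_Ico] at hk
  exact M.riskFree_pos _ (by omega) (by omega)

theorem rho_terminal : M.rho T = 1 := by simp [rho]

theorem rho_eq_mul {t : ℕ} (ht : t < T) : M.rho t = M.riskFree (t + 1) * M.rho (t + 1) := by
  rw [rho, rho, Finset.prod_eq_prod_Ico_succ_bot ht]

/-- The threshold `rᵀk ≤ 1` is the sign condition `-1 + rᵀk ≤ 0`, and the square is unaffected by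
the change of sign. -/
theorem costMinus_eq_quadLoss (t : ℕ) (dm dp : Vec Ns → ℝ) (x : Vec Ns) (k : Vec N) :
    M.costMinus t dm dp x k = quadLoss (M.condLaw t x) dm dp (-1) k := by
  unfold costMinus quadLoss
  refine integral_congr_ae (Filter.Eventually.of_forall fun p => ?_)
  simp only
  split_ifs with h
  · rw [signedQuad_of_nonpos (by linarith)]; ring
  · rw [signedQuad_of_nonneg (by linarith)]; ring

theorem costPlus_eq_quadLoss (t : ℕ) (dm dp : Vec Ns → ℝ) (x : Vec Ns) (k : Vec N) :
    M.costPlus t dm dp x k = quadLoss (M.condLaw t x) dm dp 1 k := by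
  unfold costPlus quadLoss
  refine integral_congr_ae (Filter.Eventually.of_forall fun p => ?_)
  simp only
  split_ifs with h
  · rw [signedQuad_of_nonpos (by linarith)]; ring
  · rw [signedQuad_of_nonneg (by linarith)]; ring

theorem dMinus_eq_iInf {t : ℕ} (ht : t < T) (x : Vec Ns) :
    M.dMinus t x = ⨅ k : M.A t,
      quadLoss (M.condLaw t x) (M.dMinus (t + 1)) (M.dPlus (t + 1)) (-1) k := by
  rw [M.dMinus_step ht]; simp only [costMinus_eq_quadLoss]

theorem dPlus_eq_iInf {t : ℕ} (ht : t < T) (x : Vec Ns) :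
    M.dPlus t x = ⨅ k : M.A t,
      quadLoss (M.condLaw t x) (M.dMinus (t + 1)) (M.dPlus (t + 1)) 1 k := by
  rw [M.dPlus_step ht]; simp only [costPlus_eq_quadLoss]

/-- The portfolio `0` costs at most `1`. The bounds hold at every state, even where the integrand is
not measurable, since the integral then has the default value `0`. -/
theorem d_mem_Icc {t : ℕ} (ht : t ≤ T) (x : Vec Ns) :
    M.dMinus t x ∈ Set.Icc (0 : ℝ) 1 ∧ M.dPlus t x ∈ Set.Icc (0 : ℝ) 1 := by
  induction ht using Nat.decreasingInduction generalizing x with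
  | self => simp [dMinus_terminal, dPlus_terminal]
  | of_succ t ht ih =>
    have ha0 := fun y => (ih y).1.1
    have hb0 := fun y => (ih y).2.1
    have ha1 := fun y => (ih y).1.2
    have hb1 := fun y => (ih y).2.2
    have key : ∀ τ : ℝ, τ ^ 2 = 1 → (⨅ k : M.A t,
        quadLoss (M.condLaw t x) (M.dMinus (t + 1)) (M.dPlus (t + 1)) τ k) ∈ Set.Icc (0 : ℝ) 1 :=
      fun τ hτ => ⟨Real.iInf_nonneg fun k => quadLoss_nonneg ha0 hb0 _ _,
        (ciInf_le (bddBelow_quadLoss _ ha0 hb0 τ) ⟨0, M.zero_mem_A t ht⟩).trans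
          (quadLoss_zero_le_one ha0 hb0 ha1 hb1 hτ)⟩
    rw [M.dMinus_eq_iInf ht, M.dPlus_eq_iInf ht]
    exact ⟨key (-1) (by norm_num), key 1 (by norm_num)⟩

theorem dMinus_le_quadLoss {t : ℕ} (ht : t < T) (x : Vec Ns) {k : Vec N} (hk : k ∈ M.A t) :
    M.dMinus t x ≤ quadLoss (M.condLaw t x) (M.dMinus (t + 1)) (M.dPlus (t + 1)) (-1) k := by
  rw [M.dMinus_eq_iInf ht]
  exact ciInf_le (bddBelow_quadLoss _ (fun y => (M.d_mem_Icc ht y).1.1)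
    (fun y => (M.d_mem_Icc ht y).2.1) _) (⟨k, hk⟩ : M.A t)

theorem dPlus_le_quadLoss {t : ℕ} (ht : t < T) (x : Vec Ns) {k : Vec N} (hk : k ∈ M.A t) :
    M.dPlus t x ≤ quadLoss (M.condLaw t x) (M.dMinus (t + 1)) (M.dPlus (t + 1)) 1 k := by
  rw [M.dPlus_eq_iInf ht]
  exact ciInf_le (bddBelow_quadLoss _ (fun y => (M.d_mem_Icc ht y).1.1)
    (fun y => (M.d_mem_Icc ht y).2.1) _) (⟨k, hk⟩ : M.A t)

end FactorMarket

/-! ### Measurability and positivity of `d⁻` and `d⁺`, and existence of minimizers -/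

theorem measurable_quadLoss {X Y : Type*} [MeasurableSpace X] [MeasurableSpace Y] {N : ℕ}
    (κ : Kernel X (Vec N × Y)) [IsSFiniteKernel κ] {a b : Y → ℝ} (ha : Measurable a)
    (hb : Measurable b) (τ : ℝ) {k : X → Vec N} (hk : Measurable k) :
    Measurable fun x => quadLoss (κ x) a b τ (k x) := by
  have h : Measurable fun q : X × (Vec N × Y) =>
      signedQuad (a q.2.2) (b q.2.2) (τ + dotp q.2.1 (k q.1)) := by
    have h1 : Measurable fun q : X × (Vec N × Y) => τ + dotp q.2.1 (k q.1) :=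
      measurable_const.add (measurable_dotp.comp
        ((measurable_fst.comp measurable_snd).prodMk (hk.comp measurable_fst)))
    have h2 : Measurable fun q : X × (Vec N × Y) => q.2.2 := measurable_snd.comp measurable_snd
    exact ((ha.comp h2).mul ((h1.min measurable_const).pow_const 2)).add
      ((hb.comp h2).mul ((h1.max measurable_const).pow_const 2))
  exact h.stronglyMeasurable.integral_kernel_prod_right'.measurable

namespace FactorMarket

variable {Ω : Type*} [mΩ : MeasurableSpace Ω] {P : Measure Ω} [IsProbabilityMeasure P]
  {T N Ns Ne Nx : ℕ} (M : FactorMarket P T N Ns Ne Nx)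

/-- The functions `d⁻ₜ` and `d⁺ₜ` are measurable and positive up to null sets of states. -/
structure IsRegularAt (t : ℕ) : Prop where
  aemeasurable_minus : AEMeasurable (M.dMinus t) (P.map (M.s t))
  aemeasurable_plus : AEMeasurable (M.dPlus t) (P.map (M.s t))
  pos_minus : ∀ᵐ x ∂(P.map (M.s t)), 0 < M.dMinus t x
  pos_plus : ∀ᵐ x ∂(P.map (M.s t)), 0 < M.dPlus t x

/-- The conditional law at `x` is one to which the one-period results apply. -/
structure IsGoodState (t : ℕ) (x : Vec Ns) : Prop where
  lossData : IsLossData (M.condLaw t x) (M.dMinus (t + 1)) (M.dPlus (t + 1))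
  pos_minus : ∀ᵐ p ∂(M.condLaw t x), 0 < M.dMinus (t + 1) p.2
  pos_plus : ∀ᵐ p ∂(M.condLaw t x), 0 < M.dPlus (t + 1) p.2
  posDef : (Matrix.of fun i j : Fin N => cov[fun p : Vec N × Vec Ns => p.1 i,
    fun p : Vec N × Vec Ns => p.1 j; M.condLaw t x]).PosDef

variable {M}

theorem isRegularAt_terminal : M.IsRegularAt T := by
  have h1 : M.dMinus T = fun _ => 1 := funext M.dMinus_terminal
  have h2 : M.dPlus T = fun _ => 1 := funext M.dPlus_terminal
  constructor <;> simp [h1, h2]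

theorem IsRegularAt.ae_isGoodState {t : ℕ} (h : M.IsRegularAt (t + 1)) (ht : t < T) :
    ∀ᵐ x ∂(P.map (M.s t)), M.IsGoodState t x := by
  filter_upwards [M.ae_condLaw_of_ae ht h.aemeasurable_minus.ae_eq_mk,
    M.ae_condLaw_of_ae ht h.aemeasurable_plus.ae_eq_mk, M.ae_condLaw_of_ae ht h.pos_minus,
    M.ae_condLaw_of_ae ht h.pos_plus, M.secondMoment t ht, M.cov_posDef t ht]
    with x h1 h2 h3 h4 h5 h6
  have d := M.d_mem_Icc (show t + 1 ≤ T from ht)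
  exact ⟨⟨⟨_, h.aemeasurable_minus.measurable_mk.comp measurable_snd, h1⟩,
    ⟨_, h.aemeasurable_plus.measurable_mk.comp measurable_snd, h2⟩,
    fun y => (d y).1.1, fun y => (d y).2.1, fun y => (d y).1.2, fun y => (d y).2.2, h5⟩, h3, h4, h6⟩

theorem IsRegularAt.aemeasurable_quadLoss {t : ℕ} (h : M.IsRegularAt (t + 1)) (ht : t < T)
    (τ : ℝ) {k : Vec Ns → Vec N} (hk : Measurable k) :
    AEMeasurable (fun x => quadLoss (M.condLaw t x) (M.dMinus (t + 1)) (M.dPlus (t + 1)) τ (k x))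
      (P.map (M.s t)) := by
  refine ⟨_, measurable_quadLoss (M.condLaw t) h.aemeasurable_minus.measurable_mk
    h.aemeasurable_plus.measurable_mk τ hk, ?_⟩
  filter_upwards [M.ae_condLaw_of_ae ht h.aemeasurable_minus.ae_eq_mk,
    M.ae_condLaw_of_ae ht h.aemeasurable_plus.ae_eq_mk] with x h1 h2
  exact quadLoss_congr h1 h2 _ _

theorem dMinus_eq_of_isMinOn {t : ℕ} (ht : t < T) {x : Vec Ns} {k : Vec N} (hk : k ∈ M.A t)
    (hmin : IsMinOn (M.costMinus t (M.dMinus (t + 1)) (M.dPlus (t + 1)) x) (M.A t) k) :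
    M.dMinus t x = quadLoss (M.condLaw t x) (M.dMinus (t + 1)) (M.dPlus (t + 1)) (-1) k := by
  refine le_antisymm (M.dMinus_le_quadLoss ht x hk) ?_
  rw [M.dMinus_step ht, ← costMinus_eq_quadLoss]
  have : Nonempty (M.A t) := ⟨⟨k, hk⟩⟩
  exact le_ciInf fun k' => hmin k'.2

theorem dPlus_eq_of_isMinOn {t : ℕ} (ht : t < T) {x : Vec Ns} {k : Vec N} (hk : k ∈ M.A t)
    (hmin : IsMinOn (M.costPlus t (M.dMinus (t + 1)) (M.dPlus (t + 1)) x) (M.A t) k) :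
    M.dPlus t x = quadLoss (M.condLaw t x) (M.dMinus (t + 1)) (M.dPlus (t + 1)) 1 k := by
  refine le_antisymm (M.dPlus_le_quadLoss ht x hk) ?_
  rw [M.dPlus_step ht, ← costPlus_eq_quadLoss]
  have : Nonempty (M.A t) := ⟨⟨k, hk⟩⟩
  exact le_ciInf fun k' => hmin k'.2

theorem IsGoodState.quadLoss_pos {t : ℕ} {x : Vec Ns} (h : M.IsGoodState t x) {τ : ℝ}
    (hτ : τ ≠ 0) (k : Vec N) :
    0 < quadLoss (M.condLaw t x) (M.dMinus (t + 1)) (M.dPlus (t + 1)) τ k :=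
  (quadLoss_nonneg h.lossData.a_nonneg h.lossData.b_nonneg _ _).lt_of_ne fun h0 =>
    hτ (h.lossData.eq_zero_of_quadLoss_eq_zero h.pos_minus h.pos_plus h.posDef h0.symm).1

/-- The cone need not be closed, so its infimum may not be attained. It is bounded below by the
minimum over all of `ℝᴺ`, which is attained and positive. -/
theorem IsGoodState.iInf_quadLoss_pos {t : ℕ} (ht : t < T) {x : Vec Ns} (h : M.IsGoodState t x)
    {τ : ℝ} (hτ : τ ≠ 0) :
    0 < ⨅ k : M.A t, quadLoss (M.condLaw t x) (M.dMinus (t + 1)) (M.dPlus (t + 1)) τ k := by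
  obtain ⟨k₀, -, hk₀⟩ := h.lossData.exists_isMinOn h.pos_minus h.pos_plus h.posDef τ
    isClosed_univ Set.univ_nonempty
  have : Nonempty (M.A t) := ⟨⟨0, M.zero_mem_A t ht⟩⟩
  exact (h.quadLoss_pos hτ k₀).trans_le (le_ciInf fun k => hk₀ (Set.mem_univ _))

/-- At good states the loss is continuous in `k`, so the infimum over the possibly uncountable cone
equals one over a countable dense subset. -/
theorem IsRegularAt.aemeasurable_iInf_quadLoss {t : ℕ} (h : M.IsRegularAt (t + 1)) (ht : t < T)
    (τ : ℝ) : AEMeasurable (fun x => ⨅ k : M.A t,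
      quadLoss (M.condLaw t x) (M.dMinus (t + 1)) (M.dPlus (t + 1)) τ k) (P.map (M.s t)) := by
  have : Nonempty (M.A t) := ⟨⟨0, M.zero_mem_A t ht⟩⟩
  let q := TopologicalSpace.denseSeq (M.A t)
  have hq : DenseRange q := TopologicalSpace.denseRange_denseSeq _
  have hmeas : AEMeasurable (fun x => ⨅ n : ℕ,
      quadLoss (M.condLaw t x) (M.dMinus (t + 1)) (M.dPlus (t + 1)) τ (q n)) (P.map (M.s t)) :=
    AEMeasurable.iInf fun n => h.aemeasurable_quadLoss ht τ measurable_const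
  refine hmeas.congr ?_
  filter_upwards [h.ae_isGoodState ht] with x hx
  have hcont : Continuous fun k : M.A t =>
      quadLoss (M.condLaw t x) (M.dMinus (t + 1)) (M.dPlus (t + 1)) τ k :=
    hx.lossData.continuous_quadLoss.comp (continuous_const.prodMk continuous_subtype_val)
  have hbdd := bddBelow_quadLoss (A := M.A t) (M.condLaw t x) hx.lossData.a_nonneg
    hx.lossData.b_nonneg τ
  refine le_antisymm (le_ciInf fun k => ?_) (le_ciInf fun n => ciInf_le hbdd (q n))
  refine le_of_forall_pos_lt_add fun ε hε => ?_
  obtain ⟨n, hn⟩ := hq.exists_mem_open (isOpen_lt hcont continuous_const)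
    ⟨k, lt_add_of_pos_right _ hε⟩
  refine lt_of_le_of_lt (ciInf_le ?_ n) hn
  exact hbdd.mono (by rintro _ ⟨m, rfl⟩; exact ⟨q m, rfl⟩)

theorem IsRegularAt.of_succ {t : ℕ} (h : M.IsRegularAt (t + 1)) (ht : t < T) :
    M.IsRegularAt t where
  aemeasurable_minus := by
    rw [funext (M.dMinus_eq_iInf ht)]
    exact h.aemeasurable_iInf_quadLoss ht _
  aemeasurable_plus := by
    rw [funext (M.dPlus_eq_iInf ht)]
    exact h.aemeasurable_iInf_quadLoss ht _
  pos_minus := by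
    filter_upwards [h.ae_isGoodState ht] with x hg
    rw [M.dMinus_eq_iInf ht]
    exact hg.iInf_quadLoss_pos ht (by norm_num)
  pos_plus := by
    filter_upwards [h.ae_isGoodState ht] with x hg
    rw [M.dPlus_eq_iInf ht]
    exact hg.iInf_quadLoss_pos ht (by norm_num)

variable (M) in
theorem isRegularAt {t : ℕ} (ht : t ≤ T) : M.IsRegularAt t := by
  induction ht using Nat.decreasingInduction with
  | self => exact isRegularAt_terminal
  | of_succ t ht ih => exact ih.of_succ ht

variable (M) in
theorem ae_isGoodState {t : ℕ} (ht : t < T) : ∀ᵐ x ∂(P.map (M.s t)), M.IsGoodState t x :=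
  (M.isRegularAt ht).ae_isGoodState ht

theorem IsRegularAt.exists_minimizer {t : ℕ} (h : M.IsRegularAt (t + 1)) (ht : t < T)
    (hA : IsClosed (M.A t)) (τ : ℝ) :
    ∃ k : Vec Ns → Vec N, Measurable k ∧ (∀ x, k x ∈ M.A t) ∧ ∀ᵐ x ∂(P.map (M.s t)),
      IsMinOn (quadLoss (M.condLaw t x) (M.dMinus (t + 1)) (M.dPlus (t + 1)) τ) (M.A t) (k x) := by
  classical
  have hgood : ∀ᵐ x ∂(P.map (M.s t)), M.IsGoodState t x ∧ ∀ k,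
      quadLoss (M.condLaw t x) (M.dMinus (t + 1)) (M.dPlus (t + 1)) τ k
        = quadLoss (M.condLaw t x) (h.aemeasurable_minus.mk _) (h.aemeasurable_plus.mk _) τ k := by
    filter_upwards [h.ae_isGoodState ht, M.ae_condLaw_of_ae ht h.aemeasurable_minus.ae_eq_mk,
      M.ae_condLaw_of_ae ht h.aemeasurable_plus.ae_eq_mk] with x h0 h1 h2
    exact ⟨h0, fun k => quadLoss_congr h1 h2 _ _⟩
  obtain ⟨G, hG, hGm, hGood⟩ := hgood.exists_measurable_mem
  -- The selection theorem needs its hypotheses at every `x`. Measurable versions of the weights are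
  -- used on `G`; off the good set the loss is replaced by `‖k‖`, which is minimized at `0`.
  let f : Vec Ns → Vec N → ℝ := fun x k => if x ∈ G then
    quadLoss (M.condLaw t x) (h.aemeasurable_minus.mk _) (h.aemeasurable_plus.mk _) τ k else ‖k‖
  have hf : ∀ x ∈ G,
      f x = quadLoss (M.condLaw t x) (M.dMinus (t + 1)) (M.dPlus (t + 1)) τ := fun x hx => by
    funext k
    simp only [f, if_pos hx, (hGood x hx).2 k]
  have hf' : ∀ x ∉ G, f x = fun k => ‖k‖ := fun x hx => by
    funext k
    simp only [f, if_neg hx]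
  obtain ⟨u, hu, hmem⟩ := exists_measurable_isMinOn (f := f) hA
    (fun k => Measurable.ite hGm (measurable_quadLoss _ h.aemeasurable_minus.measurable_mk
      h.aemeasurable_plus.measurable_mk τ measurable_const) measurable_const)
    (fun x => by
      by_cases hx : x ∈ G
      · rw [hf x hx]
        exact (hGood x hx).1.lossData.continuous_quadLoss.comp
          (continuous_const.prodMk continuous_id)
      · rw [hf' x hx]
        exact continuous_norm)
    ⟨0, M.zero_mem_A t ht⟩
    (fun x => by
      by_cases hx : x ∈ G
      · rw [hf x hx]
        have g := (hGood x hx).1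
        exact g.lossData.exists_isMinOn g.pos_minus g.pos_plus g.posDef τ hA
          ⟨0, M.zero_mem_A t ht⟩
      · rw [hf' x hx]
        exact ⟨0, M.zero_mem_A t ht, isMinOn_iff.2 fun k _ => by simp⟩)
  refine ⟨u, hu, fun x => (hmem x).1, ?_⟩
  filter_upwards [hG] with x hx
  rw [← hf x hx]
  exact (hmem x).2

variable (M) in
theorem exists_areMinimizers (hA : ∀ t, t < T → IsClosed (M.A t)) :
    ∃ km kp, M.AreMinimizers km kp := by
  have key : ∀ (τ : ℝ) (t : ℕ), ∃ k : Vec Ns → Vec N, t < T → Measurable k ∧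
      (∀ x, k x ∈ M.A t) ∧ ∀ᵐ x ∂(P.map (M.s t)), IsMinOn
        (quadLoss (M.condLaw t x) (M.dMinus (t + 1)) (M.dPlus (t + 1)) τ) (M.A t) (k x) := by
    intro τ t
    by_cases ht : t < T
    · obtain ⟨k, h⟩ := (M.isRegularAt ht).exists_minimizer ht (hA t ht) τ
      exact ⟨k, fun _ => h⟩
    · exact ⟨0, fun h => absurd h ht⟩
  choose km hm using key (-1)
  choose kp hp using key 1
  refine ⟨km, kp, fun t ht => (hm t ht).1, fun t ht => (hp t ht).1, fun t ht => (hm t ht).2.1,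
    fun t ht => (hp t ht).2.1, fun t ht => ?_, fun t ht => ?_⟩
  · filter_upwards [(hm t ht).2.2] with x hx
    rwa [funext (M.costMinus_eq_quadLoss t _ _ x)]
  · filter_upwards [(hp t ht).2.2] with x hx
    rwa [funext (M.costPlus_eq_quadLoss t _ _ x)]

end FactorMarket

/-! ### Infeasibility when `d_0⁻ = 1` or `d_0⁺ = 1` -/

section OnePeriod

variable {N : ℕ} {Y : Type*} [MeasurableSpace Y] {μ : Measure (Vec N × Y)}
  [IsProbabilityMeasure μ] {a b : Y → ℝ}

/-- If no portfolio of a cone lowers the cost below `1`, then none has a mean excess return of the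
sign opposite to `τ`. -/
theorem mul_integral_dotp_nonneg_of_one_le_quadLoss (hμ : MemLp (fun p : Vec N × Y => p.1) 2 μ)
    (ha0 : ∀ y, 0 ≤ a y) (hb0 : ∀ y, 0 ≤ b y) (ha1 : ∀ y, a y ≤ 1) (hb1 : ∀ y, b y ≤ 1)
    {τ : ℝ} (hτ : τ ^ 2 = 1) {A : Set (Vec N)} (hA : ∀ c : ℝ, 0 < c → ∀ k ∈ A, c • k ∈ A)
    (h : ∀ k ∈ A, 1 ≤ quadLoss μ a b τ k) {k : Vec N} (hk : k ∈ A) :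
    0 ≤ τ * ∫ p, dotp p.1 k ∂μ := by
  have hL := memLp_dotp hμ k
  have h1 : Integrable (fun p : Vec N × Y => dotp p.1 k) μ := hL.integrable (by norm_num)
  have h2 : Integrable (fun p : Vec N × Y => dotp p.1 k ^ 2) μ := hL.integrable_sq
  set m := ∫ p, dotp p.1 k ∂μ
  set q := ∫ p, dotp p.1 k ^ 2 ∂μ
  have hq : 0 ≤ q := integral_nonneg fun p => sq_nonneg _
  -- The loss of `ε • k` is at most `E[(τ + ε rᵀk)²] = 1 + 2ετm + ε²q`; subtract `1` and divide by
  -- `ε`.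
  have key : ∀ ε : ℝ, 0 < ε → 0 ≤ 2 * (τ * m) + ε * q := fun ε hε => by
    have hlin : Integrable (fun p : Vec N × Y => 1 + 2 * ε * τ * dotp p.1 k) μ :=
      (integrable_const 1).add (h1.const_mul _)
    have hint : Integrable (fun p : Vec N × Y =>
        1 + 2 * ε * τ * dotp p.1 k + ε ^ 2 * dotp p.1 k ^ 2) μ := hlin.add (h2.const_mul _)
    have hle : quadLoss μ a b τ (ε • k) ≤ 1 + 2 * ε * τ * m + ε ^ 2 * q := by
      have heq : ∫ p, (1 + 2 * ε * τ * dotp p.1 k + ε ^ 2 * dotp p.1 k ^ 2) ∂μ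
          = 1 + 2 * ε * τ * m + ε ^ 2 * q := by
        rw [integral_add hlin (h2.const_mul _),
          integral_add (integrable_const 1) (h1.const_mul _), integral_const_mul,
          integral_const_mul]
        simp [m, q]
      rw [← heq]
      refine integral_mono_of_nonneg
        (Filter.Eventually.of_forall fun p => signedQuad_nonneg (ha0 _) (hb0 _) _) hint
        (Filter.Eventually.of_forall fun p => ?_)
      refine (signedQuad_le_sq (ha1 _) (hb1 _) _).trans (le_of_eq ?_)
      rw [dotp_smul]
      linear_combination hτ
    have h3 := (h _ (hA ε hε k hk)).trans hle
    have h4 : 0 ≤ ε * (2 * (τ * m) + ε * q) := by linarith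
    exact nonneg_of_mul_nonneg_right h4 hε
  by_contra hneg
  push Not at hneg
  -- This `ε` makes `ε q ≤ -τm`, so the bracket would be at most `τm < 0`; the `+ 1` guards against
  -- `q = 0`.
  have h5 := key (-(τ * m) / (q + 1)) (div_pos (by linarith) (by linarith))
  have h6 : -(τ * m) / (q + 1) * q ≤ -(τ * m) := by
    rw [div_mul_eq_mul_div, div_le_iff₀ (by linarith)]
    nlinarith
  linarith

theorem ae_eq_one_of_one_le_integral {X : Type*} [MeasurableSpace X] {ν : Measure X}
    [IsProbabilityMeasure ν] {f : X → ℝ} (hf : ∀ x, f x ≤ 1) (h : 1 ≤ ∫ x, f x ∂ν) :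
    ∀ᵐ x ∂ν, f x = 1 := by
  -- A non-integrable `f` would have integral `0`, contradicting `h`.
  have hint : Integrable f ν := by
    by_contra hn
    rw [integral_undef hn] at h
    linarith
  have h0 : ∫ x, (1 - f x) ∂ν = 0 := by
    refine le_antisymm ?_ (integral_nonneg fun x => sub_nonneg.2 (hf x))
    rw [integral_sub (integrable_const 1) hint]
    simpa using h
  have := (integral_eq_zero_iff_of_nonneg (fun x => sub_nonneg.2 (hf x))
    ((integrable_const 1).sub hint)).1 h0
  filter_upwards [this] with x hx
  exact (sub_eq_zero.1 hx).symm

end OnePeriod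

namespace FactorMarket

variable {Ω : Type*} [mΩ : MeasurableSpace Ω] {P : Measure Ω} [IsProbabilityMeasure P]
  {T N Ns Ne Nx : ℕ} (M : FactorMarket P T N Ns Ne Nx)

/-- A converse to `ae_condLaw_of_ae`. Passing from iterated null sets back to a joint one needs a
measurable set, hence the measurable version of `g`. -/
theorem ae_eq_of_ae_condLaw {t : ℕ} (ht : t < T) {g : Vec Ns → ℝ}
    (hg : AEMeasurable g (P.map (M.s (t + 1)))) {c : ℝ}
    (h : ∀ᵐ x ∂(P.map (M.s t)), ∀ᵐ p ∂(M.condLaw t x), g p.2 = c) :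
    ∀ᵐ y ∂(P.map (M.s (t + 1))), g y = c := by
  have hs := M.measurable_s ht.le
  have hs' := M.measurable_s (Nat.succ_le_of_lt ht)
  have : IsProbabilityMeasure (P.map (M.s t)) := Measure.isProbabilityMeasure_map hs.aemeasurable
  have hset : MeasurableSet {y | hg.mk g y = c} :=
    measurableSet_eq_fun hg.measurable_mk measurable_const
  have h1 : ∀ᵐ x ∂(P.map (M.s t)), ∀ᵐ p ∂(M.condLaw t x), hg.mk g p.2 = c := by
    filter_upwards [h, M.ae_condLaw_of_ae ht hg.ae_eq_mk] with x hx hx'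
    filter_upwards [hx, hx'] with p hp hp'
    rw [← hp', hp]
  have h2 : ∀ᵐ z ∂(P.map (M.s t) ⊗ₘ M.condLaw t), hg.mk g z.2.2 = c :=
    Measure.ae_compProd_of_ae_ae (hset.preimage (measurable_snd.comp measurable_snd)) h1
  have heq : P.map (M.s t) ⊗ₘ M.condLaw t = P.map fun ω => (M.s t ω, M.nextObs t ω) :=
    compProd_map_condDistrib (M.measurable_nextObs ht).aemeasurable
  rw [heq] at h2
  have h3 : ∀ᵐ ω ∂P, hg.mk g (M.s (t + 1) ω) = c :=
    ae_of_ae_map (hs.prodMk (M.measurable_nextObs ht)).aemeasurable h2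
  have h4 : ∀ᵐ y ∂(P.map (M.s (t + 1))), hg.mk g y = c :=
    (ae_map_iff hs'.aemeasurable hset).2 h3
  filter_upwards [h4, hg.ae_eq_mk] with y hy hy'
  rw [hy', hy]

/-- Holding no risky asset gives `d_t⁻ ≤ E[d_{t+1}⁻ | s_t] ≤ 1`, so the value `1` propagates forward
in time. -/
theorem ae_dMinus_eq_one (h0 : M.dMinus 0 M.sInit = 1) {t : ℕ} (ht : t ≤ T) :
    ∀ᵐ x ∂(P.map (M.s t)), M.dMinus t x = 1 := by
  induction t with
  | zero => rw [M.map_s_zero]; simpa [ae_dirac_eq] using h0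
  | succ t ih =>
    have d := M.d_mem_Icc ht
    refine M.ae_eq_of_ae_condLaw ht (M.isRegularAt ht).aemeasurable_minus ?_
    filter_upwards [ih (Nat.le_of_succ_le ht)] with x hx
    refine ae_eq_one_of_one_le_integral (fun p => (d p.2).1.2) ?_
    have h1 := M.dMinus_le_quadLoss ht x (M.zero_mem_A t ht)
    rw [hx] at h1
    refine h1.trans (le_of_eq (integral_congr_ae (Filter.Eventually.of_forall fun p => ?_)))
    simp [dotp_zero, signedQuad]

theorem ae_dPlus_eq_one (h0 : M.dPlus 0 M.sInit = 1) {t : ℕ} (ht : t ≤ T) :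
    ∀ᵐ x ∂(P.map (M.s t)), M.dPlus t x = 1 := by
  induction t with
  | zero => rw [M.map_s_zero]; simpa [ae_dirac_eq] using h0
  | succ t ih =>
    have d := M.d_mem_Icc ht
    refine M.ae_eq_of_ae_condLaw ht (M.isRegularAt ht).aemeasurable_plus ?_
    filter_upwards [ih (Nat.le_of_succ_le ht)] with x hx
    refine ae_eq_one_of_one_le_integral (fun p => (d p.2).2.2) ?_
    have h1 := M.dPlus_le_quadLoss ht x (M.zero_mem_A t ht)
    rw [hx] at h1
    refine h1.trans (le_of_eq (integral_congr_ae (Filter.Eventually.of_forall fun p => ?_)))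
    simp [dotp_zero, signedQuad]

/-- The factor `1` here, and `-1` in the mirror statement, is the sign `σ` that lets both cases
share one supermartingale argument. -/
theorem ae_mean_nonpos_of_dMinus (h0 : M.dMinus 0 M.sInit = 1) {t : ℕ} (ht : t < T) :
    ∀ᵐ x ∂(P.map (M.s t)), ∀ k ∈ M.A t, (1 : ℝ) * ∫ p, dotp p.1 k ∂(M.condLaw t x) ≤ 0 := by
  filter_upwards [M.ae_dMinus_eq_one h0 ht.le, M.ae_isGoodState ht] with x hx hg k hk
  have d := hg.lossData
  have := mul_integral_dotp_nonneg_of_one_le_quadLoss d.memLp d.a_nonneg d.b_nonneg d.a_le_one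
    d.b_le_one (τ := -1) (by norm_num) (M.smul_mem_A t ht)
    (fun k hk => hx ▸ M.dMinus_le_quadLoss ht x hk) hk
  linarith

theorem ae_mean_nonneg_of_dPlus (h0 : M.dPlus 0 M.sInit = 1) {t : ℕ} (ht : t < T) :
    ∀ᵐ x ∂(P.map (M.s t)), ∀ k ∈ M.A t, (-1 : ℝ) * ∫ p, dotp p.1 k ∂(M.condLaw t x) ≤ 0 := by
  filter_upwards [M.ae_dPlus_eq_one h0 ht.le, M.ae_isGoodState ht] with x hx hg k hk
  have d := hg.lossData
  have := mul_integral_dotp_nonneg_of_one_le_quadLoss d.memLp d.a_nonneg d.b_nonneg d.a_le_one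
    d.b_le_one (τ := 1) (by norm_num) (M.smul_mem_A t ht)
    (fun k hk => hx ▸ M.dPlus_le_quadLoss ht x hk) hk
  linarith

theorem measurable_wealth {x₀ : ℝ} {π : ℕ → Ω → Vec N} (hπ : M.IsAdmissible π) {t : ℕ}
    (ht : t ≤ T) : Measurable[M.info t] (M.wealth x₀ π t) := by
  induction t with
  | zero => exact measurable_const
  | succ t ih =>
    have hle := M.info.mono (Nat.le_succ t)
    have h1 : Measurable[M.info (t + 1)] (M.wealth x₀ π t) :=
      (ih (Nat.le_of_succ_le ht)).mono hle le_rfl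
    have h2 : Measurable[M.info (t + 1)] (π t) := (hπ t ht).1.mono hle le_rfl
    exact (h1.const_mul _).add
      (measurable_dotp.comp ((M.r_meas (t + 1) (by omega) ht).prodMk h2))

/-- The mean excess return of a bounded portfolio inherits its sign from the conditional means. -/
theorem mul_integral_dotp_nonpos {t : ℕ} (ht : t < T) {σ : ℝ}
    (hσ : ∀ᵐ x ∂(P.map (M.s t)), ∀ k ∈ M.A t, σ * ∫ p, dotp p.1 k ∂(M.condLaw t x) ≤ 0)
    {u : Ω → Vec N} (hu : Measurable[M.info t] u) (hA : ∀ ω, u ω ∈ M.A t) {n : ℝ}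
    (hn : ∀ ω, ‖u ω‖ * ∫ p, ‖p.1‖ ∂(M.condLaw t (M.s t ω)) ≤ n) :
    Integrable (fun ω => dotp (M.r (t + 1) ω) (u ω)) P ∧
      σ * ∫ ω, dotp (M.r (t + 1) ω) (u ω) ∂P ≤ 0 := by
  have hs := M.measurable_s ht.le
  have hW : Measurable fun ω => (M.s t ω, u ω) :=
    ((M.s_meas t ht.le).prodMk hu).mono (M.info.le t) le_rfl
  have hWY : Measurable fun ω => ((M.s t ω, u ω), M.nextObs t ω) :=
    hW.prodMk (M.measurable_nextObs ht)
  have : IsProbabilityMeasure (P.map fun ω => (M.s t ω, u ω)) :=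
    Measure.isProbabilityMeasure_map hW.aemeasurable
  let F : (Vec Ns × Vec N) × (Vec N × Vec Ns) → ℝ := fun z => dotp z.2.1 z.1.2
  have hF : Measurable F := measurable_dotp.comp
    ((measurable_fst.comp measurable_snd).prodMk (measurable_snd.comp measurable_fst))
  have hmom : ∀ᵐ ω ∂P, MemLp (fun p : Vec N × Vec Ns => p.1) 2 (M.condLaw t (M.s t ω)) :=
    ae_of_ae_map hs.aemeasurable (M.secondMoment t ht)
  have hinner : Measurable fun w : Vec Ns × Vec N => ∫ p, ‖F (w, p)‖ ∂(M.condLaw t w.1) :=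
    (StronglyMeasurable.integral_kernel_prod_right' (κ := (M.condLaw t).prodMkRight (Vec N))
      hF.norm.stronglyMeasurable).measurable
  have hinner' : Measurable fun w : Vec Ns × Vec N => ∫ p, F (w, p) ∂(M.condLaw t w.1) :=
    (StronglyMeasurable.integral_kernel_prod_right' (κ := (M.condLaw t).prodMkRight (Vec N))
      hF.stronglyMeasurable).measurable
  have hbound : ∀ᵐ ω ∂P,
      ∫ p, ‖F ((M.s t ω, u ω), p)‖ ∂(M.condLaw t (M.s t ω)) ≤ n := by
    filter_upwards [hmom] with ω hω
    refine le_trans ?_ (hn ω)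
    rw [← integral_const_mul]
    refine integral_mono_of_nonneg (Filter.Eventually.of_forall fun _ => norm_nonneg _)
      ((hω.integrable (by norm_num)).norm.const_mul _) (Filter.Eventually.of_forall fun p => ?_)
    simp only [F, Real.norm_eq_abs]
    rw [mul_comm]
    exact abs_dotp_le _ _
  have hint : Integrable F ((P.map fun ω => (M.s t ω, u ω)) ⊗ₘ
      (M.condLaw t).prodMkRight (Vec N)) := by
    refine (Measure.integrable_compProd_iff hF.aestronglyMeasurable).2 ⟨?_, ?_⟩
    · have h1 : ∀ᵐ w ∂(P.map fun ω => (M.s t ω, u ω)),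
          MemLp (fun p : Vec N × Vec Ns => p.1) 2 (M.condLaw t w.1) := by
        have h2 : (P.map fun ω => (M.s t ω, u ω)).map Prod.fst = P.map (M.s t) :=
          Measure.map_map measurable_fst hW
        exact ae_of_ae_map measurable_fst.aemeasurable (h2 ▸ M.secondMoment t ht)
      filter_upwards [h1] with w hw
      exact (memLp_dotp hw w.2).integrable (by norm_num)
    · simp only [Kernel.prodMkRight_apply]
      refine (integrable_map_measure hinner.aestronglyMeasurable hW.aemeasurable).2 ?_
      refine (integrable_const n).mono' (hinner.comp hW).aestronglyMeasurable ?_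
      filter_upwards [hbound] with ω hω
      rw [Function.comp_apply, Real.norm_of_nonneg (integral_nonneg fun _ => norm_nonneg _)]
      exact hω
  have hval := Measure.integral_compProd hint
  rw [M.compProd_condLaw ht hu] at hint hval
  refine ⟨(integrable_map_measure hF.aestronglyMeasurable hWY.aemeasurable).1 hint, ?_⟩
  rw [integral_map hWY.aemeasurable hF.aestronglyMeasurable] at hval
  simp only [Kernel.prodMkRight_apply] at hval
  rw [integral_map hW.aemeasurable hinner'.aestronglyMeasurable] at hval
  change σ * ∫ ω, F ((M.s t ω, u ω), M.nextObs t ω) ∂P ≤ 0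
  rw [hval, ← integral_const_mul]
  refine integral_nonpos_of_ae ?_
  filter_upwards [ae_of_ae_map hs.aemeasurable hσ] with ω hω
  exact hω _ (hA ω)

/-- A terminal wealth that is integrable inherits the supermartingale inequality from the
one-period conditional means, although the intermediate wealths need not be integrable. -/
theorem mul_setIntegral_wealth_le {σ : ℝ}
    (hσ : ∀ t, t < T → ∀ᵐ x ∂(P.map (M.s t)), ∀ k ∈ M.A t,
      σ * ∫ p, dotp p.1 k ∂(M.condLaw t x) ≤ 0)
    {x₀ : ℝ} {π : ℕ → Ω → Vec N} (hπ : M.IsAdmissible π)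
    (hint : Integrable (M.wealth x₀ π T) P) {t : ℕ} (ht : t ≤ T) {S : Set Ω}
    (hS : MeasurableSet[M.info t] S) (hSint : IntegrableOn (M.wealth x₀ π t) S P) :
    σ * ∫ ω in S, M.wealth x₀ π T ω ∂P ≤ σ * (M.rho t * ∫ ω in S, M.wealth x₀ π t ω ∂P) := by
  induction ht using Nat.decreasingInduction generalizing S with
  | self => simp [M.rho_terminal]
  | of_succ t ht ih =>
    let m : Vec Ns → ℝ := fun x => ∫ p, ‖p.1‖ ∂(M.condLaw t x)
    have hm : Measurable m := (StronglyMeasurable.integral_kernel_prod_right' (κ := M.condLaw t)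
      (f := fun z : Vec Ns × (Vec N × Vec Ns) => ‖z.2.1‖)
      (measurable_fst.comp measurable_snd).norm.stronglyMeasurable).measurable
    have hm0 : ∀ x, 0 ≤ m x := fun x => integral_nonneg fun _ => norm_nonneg _
    -- Conditional first moments are almost surely finite but not uniformly bounded. Truncating `R`,
    -- rather than `‖π t‖` alone, bounds the conditional mean of `|rᵀπ|`.
    let R : Ω → ℝ := fun ω => ‖π t ω‖ * m (M.s t ω)
    have hR : Measurable[M.info t] R :=
      (measurable_snd.norm.mul (hm.comp measurable_fst)).comp
        ((M.s_meas t ht.le).prodMk (hπ t ht).1)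
    let Sn : ℕ → Set Ω := fun n => S ∩ R ⁻¹' Set.Iic (n : ℝ)
    have hSn' : ∀ n, MeasurableSet[M.info t] (Sn n) := fun n =>
      hS.inter (hR measurableSet_Iic)
    have hSn : ∀ n, MeasurableSet (Sn n) := fun n => M.info.le t _ (hSn' n)
    have hmono : Monotone Sn := fun i j hij =>
      Set.inter_subset_inter_right S
        (Set.preimage_mono (Set.Iic_subset_Iic.2 (Nat.cast_le.2 hij)))
    have hUnion : ⋃ n, Sn n = S := by
      refine Set.Subset.antisymm (Set.iUnion_subset fun n => Set.inter_subset_left) fun ω hω => ?_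
      obtain ⟨n, hn⟩ := exists_nat_ge (R ω)
      exact Set.mem_iUnion.2 ⟨n, hω, hn⟩
    have hstep : ∀ n, σ * ∫ ω in Sn n, M.wealth x₀ π T ω ∂P
        ≤ σ * (M.rho t * ∫ ω in Sn n, M.wealth x₀ π t ω ∂P) := by
      intro n
      have hSnint : IntegrableOn (M.wealth x₀ π t) (Sn n) P :=
        hSint.mono_set Set.inter_subset_left
      -- Switching the portfolio to `0` off `Sn n` keeps it in the cone.
      obtain ⟨hdi, hdn⟩ := M.mul_integral_dotp_nonpos ht (hσ t ht)
        (u := (Sn n).indicator (π t)) (n := n) ((hπ t ht).1.indicator (hSn' n))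
        (fun ω => by
          by_cases hω : ω ∈ Sn n
          · rw [Set.indicator_of_mem hω]; exact (hπ t ht).2 ω
          · rw [Set.indicator_of_notMem hω]; exact M.zero_mem_A t ht)
        (fun ω => by
          by_cases hω : ω ∈ Sn n
          · rw [Set.indicator_of_mem hω]; exact hω.2
          · rw [Set.indicator_of_notMem hω]; simp)
      have hind : (fun ω => dotp (M.r (t + 1) ω) ((Sn n).indicator (π t) ω))
          = (Sn n).indicator fun ω => dotp (M.r (t + 1) ω) (π t ω) := by
        funext ω
        by_cases hω : ω ∈ Sn n
        · simp only [Set.indicator_of_mem hω]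
        · simp only [Set.indicator_of_notMem hω, dotp_zero]
      rw [hind] at hdi hdn
      rw [integral_indicator (hSn n)] at hdn
      have hdi' : IntegrableOn (fun ω => dotp (M.r (t + 1) ω) (π t ω)) (Sn n) P :=
        (integrable_indicator_iff (hSn n)).1 hdi
      have hnext : IntegrableOn (M.wealth x₀ π (t + 1)) (Sn n) P :=
        (hSnint.const_mul _).add hdi'
      have h1 := ih (M.info.mono (Nat.le_succ t) _ (hSn' n)) hnext
      have h2 : ∫ ω in Sn n, M.wealth x₀ π (t + 1) ω ∂P
          = M.riskFree (t + 1) * ∫ ω in Sn n, M.wealth x₀ π t ω ∂P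
            + ∫ ω in Sn n, dotp (M.r (t + 1) ω) (π t ω) ∂P := by
        rw [← integral_const_mul, ← integral_add (hSnint.const_mul _) hdi']
        rfl
      rw [h2] at h1
      rw [M.rho_eq_mul ht]
      have h3 := mul_nonpos_of_nonneg_of_nonpos (M.rho_pos (t + 1)).le hdn
      linarith
    -- Only `x_T` on `Ω` and `x_t` on `S` must be integrable for the limit; `x_{t+1}` is integrable
    -- merely on each `Sn n`.
    have lim1 := tendsto_setIntegral_of_monotone hSn hmono
      (f := M.wealth x₀ π T) (μ := P) hint.integrableOn
    have lim2 := tendsto_setIntegral_of_monotone hSn hmono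
      (f := M.wealth x₀ π t) (μ := P) (by rwa [hUnion])
    rw [hUnion] at lim1 lim2
    exact le_of_tendsto_of_tendsto' (lim1.const_mul σ) ((lim2.const_mul _).const_mul σ) hstep

theorem mul_integral_wealth_le {σ : ℝ}
    (hσ : ∀ t, t < T → ∀ᵐ x ∂(P.map (M.s t)), ∀ k ∈ M.A t,
      σ * ∫ p, dotp p.1 k ∂(M.condLaw t x) ≤ 0)
    {x₀ : ℝ} {π : ℕ → Ω → Vec N} (hπ : M.IsAdmissible π)
    (hint : Integrable (M.wealth x₀ π T) P) :
    σ * ∫ ω, M.wealth x₀ π T ω ∂P ≤ σ * (M.rho 0 * x₀) := by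
  have h0 : M.wealth x₀ π 0 = fun _ => x₀ := rfl
  have := M.mul_setIntegral_wealth_le hσ hπ hint (Nat.zero_le T) MeasurableSet.univ
    (by rw [h0]; exact (integrable_const x₀).integrableOn)
  simpa [h0] using this

theorem not_exists_isFeasible {x₀ xtg : ℝ}
    (h : (M.rho 0 * x₀ < xtg ∧ M.dMinus 0 M.sInit = 1) ∨
      (xtg < M.rho 0 * x₀ ∧ M.dPlus 0 M.sInit = 1)) : ¬ ∃ π, M.IsFeasible x₀ xtg π := by
  rintro ⟨π, hπ, hint, hmean⟩
  rcases h with ⟨hlt, h0⟩ | ⟨hlt, h0⟩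
  · have := M.mul_integral_wealth_le (fun t ht => M.ae_mean_nonpos_of_dMinus h0 ht) hπ hint
    linarith
  · have := M.mul_integral_wealth_le (fun t ht => M.ae_mean_nonneg_of_dPlus h0 ht) hπ hint
    linarith

end FactorMarket

/-! ### Dynamic programming for the expected squared gap -/

namespace FactorMarket

variable {Ω : Type*} [mΩ : MeasurableSpace Ω] {P : Measure Ω} [IsProbabilityMeasure P]
  {T N Ns Ne Nx : ℕ} (M : FactorMarket P T N Ns Ne Nx)

/-- The minimal expected squared terminal gap at time `t` in state `x`, when the current wealth
carried to the horizon at the risk-free rate exceeds the aspired terminal wealth by `z`. -/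
noncomputable def gapValue (t : ℕ) (z : ℝ) (x : Vec Ns) : ℝ :=
  signedQuad (M.dMinus t x) (M.dPlus t x) z

/-- The scaled portfolio that attains `gapValue`. -/
noncomputable def gapPortfolio (km kp : ℕ → Vec Ns → Vec N) (t : ℕ) (z : ℝ) (x : Vec Ns) : Vec N :=
  if z ≤ 0 then (-z) • km t x else z • kp t x

/-- For `z ≠ 0`, dividing `u` by `|z|` stays in the cone and reduces to the problems defining `d⁻`
and `d⁺`; for `z = 0` the value is `0`. -/
theorem gapValue_le_quadLoss {t : ℕ} (ht : t < T) (z : ℝ) (x : Vec Ns) {u : Vec N}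
    (hu : u ∈ M.A t) :
    M.gapValue t z x ≤ quadLoss (M.condLaw t x) (M.dMinus (t + 1)) (M.dPlus (t + 1)) z u := by
  unfold gapValue
  rcases lt_trichotomy z 0 with hz | rfl | hz
  · have hc : 0 < -z := by linarith
    have h1 := M.dMinus_le_quadLoss ht x (M.smul_mem_A t ht _ (inv_pos.2 hc) u hu)
    have h2 := quadLoss_mul (μ := M.condLaw t x) (a := M.dMinus (t + 1)) (b := M.dPlus (t + 1))
      hc.le (-1) ((-z)⁻¹ • u)
    rw [smul_inv_smul₀ hc.ne', show -z * -1 = z by ring] at h2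
    rw [h2, signedQuad_of_nonpos hz.le, neg_sq, mul_comm]
    gcongr
  · simpa [signedQuad] using quadLoss_nonneg (fun y => (M.d_mem_Icc ht y).1.1)
      (fun y => (M.d_mem_Icc ht y).2.1) _ _
  · have h1 := M.dPlus_le_quadLoss ht x (M.smul_mem_A t ht _ (inv_pos.2 hz) u hu)
    have h2 := quadLoss_mul (μ := M.condLaw t x) (a := M.dMinus (t + 1)) (b := M.dPlus (t + 1))
      hz.le 1 (z⁻¹ • u)
    rw [smul_inv_smul₀ hz.ne', mul_one] at h2
    rw [h2, signedQuad_of_nonneg hz.le, mul_comm]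
    gcongr

variable {M} in
theorem AreMinimizers.gapPortfolio_mem {km kp : ℕ → Vec Ns → Vec N} (h : M.AreMinimizers km kp)
    {t : ℕ} (ht : t < T) (z : ℝ) (x : Vec Ns) : gapPortfolio km kp t z x ∈ M.A t := by
  unfold gapPortfolio
  split_ifs with hz
  · rcases hz.lt_or_eq with hz | rfl
    · exact M.smul_mem_A t ht _ (by linarith) _ (h.mem_minus t ht x)
    · simpa using M.zero_mem_A t ht
  · exact M.smul_mem_A t ht _ (by linarith) _ (h.mem_plus t ht x)

variable {M} in
theorem AreMinimizers.ae_quadLoss_gapPortfolio {km kp : ℕ → Vec Ns → Vec N}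
    (h : M.AreMinimizers km kp) {t : ℕ} (ht : t < T) :
    ∀ᵐ x ∂(P.map (M.s t)), ∀ z, quadLoss (M.condLaw t x) (M.dMinus (t + 1)) (M.dPlus (t + 1)) z
      (gapPortfolio km kp t z x) = M.gapValue t z x := by
  filter_upwards [h.min_minus t ht, h.min_plus t ht] with x hm hp z
  unfold gapPortfolio gapValue
  split_ifs with hz
  · have := quadLoss_mul (μ := M.condLaw t x) (a := M.dMinus (t + 1)) (b := M.dPlus (t + 1))
      (neg_nonneg.2 hz) (-1) (km t x)
    rw [show -z * -1 = z by ring] at this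
    rw [this, signedQuad_of_nonpos hz, dMinus_eq_of_isMinOn ht (h.mem_minus t ht x) hm]
    ring
  · have hz' : 0 ≤ z := (not_le.1 hz).le
    have := quadLoss_mul (μ := M.condLaw t x) (a := M.dMinus (t + 1)) (b := M.dPlus (t + 1))
      hz' 1 (kp t x)
    rw [mul_one] at this
    rw [this, signedQuad_of_nonneg hz', dPlus_eq_of_isMinOn ht (h.mem_plus t ht x) hp]
    ring

theorem lintegral_gapValue_succ {t : ℕ} (ht : t < T) {z : Ω → ℝ} {u : Ω → Vec N}
    (hz : Measurable[M.info t] z) (hu : Measurable[M.info t] u) :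
    ∫⁻ ω, ENNReal.ofReal
        (M.gapValue (t + 1) (z ω + dotp (M.r (t + 1) ω) (u ω)) (M.s (t + 1) ω)) ∂P
      = ∫⁻ ω, ENNReal.ofReal (quadLoss (M.condLaw t (M.s t ω)) (M.dMinus (t + 1))
        (M.dPlus (t + 1)) (z ω) (u ω)) ∂P := by
  have hreg := M.isRegularAt (show t + 1 ≤ T from ht)
  set am := hreg.aemeasurable_minus.mk _
  set ap := hreg.aemeasurable_plus.mk _
  have ham : Measurable am := hreg.aemeasurable_minus.measurable_mk
  have hap : Measurable ap := hreg.aemeasurable_plus.measurable_mk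
  have hs := M.measurable_s ht.le
  have hs' := M.measurable_s (show t + 1 ≤ T from ht)
  -- Tonelli needs a measurable integrand, so `F` uses measurable versions of `d_{t+1}`. They agree
  -- with it under the law of the next state and under almost every conditional law.
  let F : (Vec Ns × (ℝ × Vec N)) × (Vec N × Vec Ns) → ℝ≥0∞ := fun q =>
    ENNReal.ofReal (signedQuad (am q.2.2) (ap q.2.2) (q.1.2.1 + dotp q.2.1 q.1.2.2))
  have hF : Measurable F := by
    have h1 : Measurable fun q : (Vec Ns × (ℝ × Vec N)) × (Vec N × Vec Ns) =>
        q.1.2.1 + dotp q.2.1 q.1.2.2 :=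
      (measurable_fst.comp (measurable_snd.comp measurable_fst)).add
        (measurable_dotp.comp ((measurable_fst.comp measurable_snd).prodMk
          (measurable_snd.comp (measurable_snd.comp measurable_fst))))
    have h2 : Measurable fun q : (Vec Ns × (ℝ × Vec N)) × (Vec N × Vec Ns) => q.2.2 :=
      measurable_snd.comp measurable_snd
    exact (((ham.comp h2).mul ((h1.min measurable_const).pow_const 2)).add
      ((hap.comp h2).mul ((h1.max measurable_const).pow_const 2))).ennreal_ofReal
  have hU : Measurable[M.info t] fun ω => (z ω, u ω) := hz.prodMk hu
  calc _ = ∫⁻ ω, F ((M.s t ω, (z ω, u ω)), M.nextObs t ω) ∂P := by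
        refine lintegral_congr_ae ?_
        filter_upwards [ae_of_ae_map hs'.aemeasurable hreg.aemeasurable_minus.ae_eq_mk,
          ae_of_ae_map hs'.aemeasurable hreg.aemeasurable_plus.ae_eq_mk] with ω h1 h2
        simp only [gapValue, F, nextObs, h1, h2, am, ap]
    _ = ∫⁻ ω, ∫⁻ p, F ((M.s t ω, (z ω, u ω)), p) ∂(M.condLaw t (M.s t ω)) ∂P :=
        M.lintegral_nextObs ht hU hF
    _ = _ := by
        refine lintegral_congr_ae ?_
        filter_upwards [ae_of_ae_map hs.aemeasurable (M.ae_isGoodState ht),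
          ae_of_ae_map hs.aemeasurable
            (M.ae_condLaw_of_ae ht hreg.aemeasurable_minus.ae_eq_mk),
          ae_of_ae_map hs.aemeasurable
            (M.ae_condLaw_of_ae ht hreg.aemeasurable_plus.ae_eq_mk)] with ω h0 h1 h2
        rw [h0.lossData.ofReal_quadLoss]
        refine lintegral_congr_ae ?_
        filter_upwards [h1, h2] with p hp hp'
        simp only [F, hp, hp', am, ap]

theorem gap_succ {x₀ c : ℝ} {π : ℕ → Ω → Vec N} {t : ℕ} (ht : t < T) (ω : Ω) :
    M.rho (t + 1) * M.wealth x₀ π (t + 1) ω - c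
      = (M.rho t * M.wealth x₀ π t ω - c)
        + dotp (M.r (t + 1) ω) (M.rho (t + 1) • π t ω) := by
  rw [dotp_smul, M.rho_eq_mul ht, wealth]
  ring

theorem lintegral_gapValue_zero (x₀ c : ℝ) (π : ℕ → Ω → Vec N) :
    ∫⁻ ω, ENNReal.ofReal (M.gapValue 0 (M.rho 0 * M.wealth x₀ π 0 ω - c) (M.s 0 ω)) ∂P
      = ENNReal.ofReal (M.gapValue 0 (M.rho 0 * x₀ - c) M.sInit) := by
  simp [wealth, M.s_zero]

theorem lintegral_gapValue_terminal (x₀ c : ℝ) (π : ℕ → Ω → Vec N) :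
    ∫⁻ ω, ENNReal.ofReal (M.gapValue T (M.rho T * M.wealth x₀ π T ω - c) (M.s T ω)) ∂P
      = ∫⁻ ω, ENNReal.ofReal ((M.wealth x₀ π T ω - c) ^ 2) ∂P := by
  simp [gapValue, dMinus_terminal, dPlus_terminal, rho_terminal, signedQuad_one_one]

variable {M} in
theorem IsAdmissible.measurable_gap {x₀ c : ℝ} {π : ℕ → Ω → Vec N} (hπ : M.IsAdmissible π)
    {t : ℕ} (ht : t ≤ T) : Measurable[M.info t] fun ω => M.rho t * M.wealth x₀ π t ω - c :=
  ((M.measurable_wealth hπ ht).const_mul _).sub_const _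

/-- No admissible policy has a smaller expected squared terminal gap than `gapValue`. -/
theorem gapValue_le_lintegral {x₀ c : ℝ} {π : ℕ → Ω → Vec N} (hπ : M.IsAdmissible π) :
    ENNReal.ofReal (M.gapValue 0 (M.rho 0 * x₀ - c) M.sInit)
      ≤ ∫⁻ ω, ENNReal.ofReal ((M.wealth x₀ π T ω - c) ^ 2) ∂P := by
  have key : ∀ t ≤ T, ENNReal.ofReal (M.gapValue 0 (M.rho 0 * x₀ - c) M.sInit)
      ≤ ∫⁻ ω, ENNReal.ofReal
        (M.gapValue t (M.rho t * M.wealth x₀ π t ω - c) (M.s t ω)) ∂P := by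
    intro t ht
    induction t with
    | zero => rw [M.lintegral_gapValue_zero]
    | succ t ih =>
      refine (ih (Nat.le_of_succ_le ht)).trans ?_
      simp only [M.gap_succ ht]
      rw [M.lintegral_gapValue_succ ht (hπ.measurable_gap (Nat.le_of_succ_le ht))
        (u := fun ω => M.rho (t + 1) • π t ω) ((hπ t ht).1.const_smul (M.rho (t + 1)))]
      refine lintegral_mono fun ω => ENNReal.ofReal_le_ofReal ?_
      exact M.gapValue_le_quadLoss ht _ _
        (M.smul_mem_A t ht _ (M.rho_pos _) _ ((hπ t ht).2 ω))
  rw [← M.lintegral_gapValue_terminal]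
  exact key T le_rfl

/-- A policy that follows `gapPortfolio` attains `gapValue`. -/
theorem lintegral_eq_gapValue {km kp : ℕ → Vec Ns → Vec N} (h : M.AreMinimizers km kp)
    {x₀ c : ℝ} {π : ℕ → Ω → Vec N} (hπ : M.IsAdmissible π)
    (heq : ∀ t, t < T → ∀ ω, M.rho (t + 1) • π t ω
      = gapPortfolio km kp t (M.rho t * M.wealth x₀ π t ω - c) (M.s t ω)) :
    ∫⁻ ω, ENNReal.ofReal ((M.wealth x₀ π T ω - c) ^ 2) ∂P
      = ENNReal.ofReal (M.gapValue 0 (M.rho 0 * x₀ - c) M.sInit) := by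
  have key : ∀ t ≤ T, ∫⁻ ω, ENNReal.ofReal
      (M.gapValue t (M.rho t * M.wealth x₀ π t ω - c) (M.s t ω)) ∂P
        = ENNReal.ofReal (M.gapValue 0 (M.rho 0 * x₀ - c) M.sInit) := by
    intro t ht
    induction t with
    | zero => rw [M.lintegral_gapValue_zero]
    | succ t ih =>
      rw [← ih (Nat.le_of_succ_le ht)]
      simp only [M.gap_succ ht]
      rw [M.lintegral_gapValue_succ ht (hπ.measurable_gap (Nat.le_of_succ_le ht))
        (u := fun ω => M.rho (t + 1) • π t ω) ((hπ t ht).1.const_smul (M.rho (t + 1)))]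
      refine lintegral_congr_ae ?_
      filter_upwards [ae_of_ae_map (M.measurable_s (Nat.le_of_succ_le ht)).aemeasurable
        (h.ae_quadLoss_gapPortfolio ht)] with ω hω
      rw [heq t ht, hω]
  rw [← M.lintegral_gapValue_terminal]
  exact key T le_rfl

theorem targetRule_eq {x₀ xtg : ℝ} (km kp : ℕ → Vec Ns → Vec N) (t : ℕ)
    (x : ℝ) (s : Vec Ns) (ht : t < T) :
    M.targetRule x₀ xtg km kp t x s = (M.rho (t + 1))⁻¹ • gapPortfolio km kp t
      (M.rho t * x - (xtg - M.rho 0 * M.dMinus 0 M.sInit * x₀) / (1 - M.dMinus 0 M.sInit)) s := by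
  have hr := (M.rho_pos (t + 1)).ne'
  have hy : M.riskFree (t + 1) * x - (xtg - M.rho 0 * M.dMinus 0 M.sInit * x₀)
      / (M.rho (t + 1) * (1 - M.dMinus 0 M.sInit))
      = (M.rho (t + 1))⁻¹ * (M.rho t * x
        - (xtg - M.rho 0 * M.dMinus 0 M.sInit * x₀) / (1 - M.dMinus 0 M.sInit)) := by
    -- Nothing excludes `1 - d = 0` here, so the quotient by it is kept intact rather than cleared.
    generalize 1 - M.dMinus 0 M.sInit = e
    rw [M.rho_eq_mul ht, mul_comm (M.rho (t + 1)) e, ← div_div]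
    field_simp
  simp only [targetRule, gapPortfolio, hy, sub_nonpos]
  split_ifs
  · rw [smul_smul, mul_neg, neg_smul]
  · rw [smul_smul]

variable {M} in
theorem AreMinimizers.isAdmissible_targetRule {km kp : ℕ → Vec Ns → Vec N}
    (h : M.AreMinimizers km kp) (x₀ xtg : ℝ) :
    M.IsAdmissible (M.feedbackPolicy x₀ (M.targetRule x₀ xtg km kp)) := by
  have hrule : ∀ t, t < T → Measurable fun q : ℝ × Vec Ns =>
      M.targetRule x₀ xtg km kp t q.1 q.2 := by
    intro t ht
    simp only [M.targetRule_eq km kp _ _ _ ht]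
    have hgap : Measurable fun q : ℝ × Vec Ns => M.rho t * q.1
        - (xtg - M.rho 0 * M.dMinus 0 M.sInit * x₀) / (1 - M.dMinus 0 M.sInit) :=
      (measurable_fst.const_mul _).sub_const _
    have hport : Measurable fun q : ℝ × Vec Ns => gapPortfolio km kp t (M.rho t * q.1
        - (xtg - M.rho 0 * M.dMinus 0 M.sInit * x₀) / (1 - M.dMinus 0 M.sInit)) q.2 :=
      Measurable.ite (measurableSet_le hgap measurable_const)
        (hgap.neg.smul ((h.meas_minus t ht).comp measurable_snd))
        (hgap.smul ((h.meas_plus t ht).comp measurable_snd))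
    exact hport.const_smul (M.rho (t + 1))⁻¹
  have hw : ∀ t, t ≤ T →
      Measurable[M.info t] (M.feedbackWealth x₀ (M.targetRule x₀ xtg km kp) t) := by
    intro t ht
    induction t with
    | zero => exact measurable_const
    | succ t ih =>
      have hle := M.info.mono (Nat.le_succ t)
      have h1 := ih (Nat.le_of_succ_le ht)
      have h2 : Measurable[M.info (t + 1)] (M.feedbackWealth x₀ (M.targetRule x₀ xtg km kp) t) :=
        h1.mono hle le_rfl
      have h3 := ((hrule t ht).comp (h1.prodMk (M.s_meas t (Nat.le_of_succ_le ht)))).mono hle le_rfl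
      exact (h2.const_mul _).add
        (measurable_dotp.comp ((M.r_meas (t + 1) (by omega) ht).prodMk h3))
  refine fun t ht => ⟨(hrule t ht).comp ((hw t ht.le).prodMk (M.s_meas t ht.le)), fun ω => ?_⟩
  simp only [feedbackPolicy, M.targetRule_eq km kp _ _ _ ht]
  exact M.smul_mem_A t ht _ (inv_pos.2 (M.rho_pos _)) _ (h.gapPortfolio_mem ht _ _)

theorem integral_sq_sub {x₀ : ℝ} {π : ℕ → Ω → Vec N} (hπ : M.IsSquareAdmissible x₀ π) (c : ℝ) :
    ∫ ω, (M.wealth x₀ π T ω - c) ^ 2 ∂P = M.varT x₀ π + (M.meanT x₀ π - c) ^ 2 := by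
  have h1 := hπ.2.integrable (by norm_num)
  have h2 := hπ.2.integrable_sq
  have h3 : ∀ ω, (M.wealth x₀ π T ω - c) ^ 2
      = M.wealth x₀ π T ω ^ 2 + (-(2 * c)) * M.wealth x₀ π T ω + c ^ 2 := fun ω => by ring
  have h4 : Integrable
      (fun ω => M.wealth x₀ π T ω ^ 2 + (-(2 * c)) * M.wealth x₀ π T ω) P :=
    h2.add (h1.const_mul _)
  simp only [h3]
  rw [integral_add h4 (integrable_const _),
    integral_add h2 (h1.const_mul _), integral_const_mul, varT, variance_eq_sub hπ.2, meanT]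
  simp only [integral_const, probReal_univ, one_smul, Pi.pow_apply]
  ring

/-- The fundamental lower bound on mean and variance. -/
theorem dMinus_mul_sq_le {x₀ : ℝ} {π : ℕ → Ω → Vec N} (hπ : M.IsSquareAdmissible x₀ π)
    {c : ℝ} (hc : M.rho 0 * x₀ ≤ c) :
    M.dMinus 0 M.sInit * (M.rho 0 * x₀ - c) ^ 2 ≤ M.varT x₀ π + (M.meanT x₀ π - c) ^ 2 := by
  have h1 := M.gapValue_le_lintegral (x₀ := x₀) (c := c) hπ.1
  have hint : Integrable (fun ω => (M.wealth x₀ π T ω - c) ^ 2) P :=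
    (hπ.2.sub (memLp_const c)).integrable_sq
  rw [← ofReal_integral_eq_lintegral_ofReal hint
      (Filter.Eventually.of_forall fun _ => sq_nonneg _), M.integral_sq_sub hπ, gapValue,
    signedQuad_of_nonpos (sub_nonpos.2 hc)] at h1
  exact (ENNReal.ofReal_le_ofReal_iff (add_nonneg (variance_nonneg _ _) (sq_nonneg _))).1 h1

variable {M} in
theorem AreMinimizers.isSquareAdmissible_targetRule {km kp : ℕ → Vec Ns → Vec N}
    (h : M.AreMinimizers km kp) {x₀ xtg c : ℝ}
    (hc : c = (xtg - M.rho 0 * M.dMinus 0 M.sInit * x₀) / (1 - M.dMinus 0 M.sInit))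
    (hle : M.rho 0 * x₀ ≤ c) :
    M.IsSquareAdmissible x₀ (M.feedbackPolicy x₀ (M.targetRule x₀ xtg km kp)) ∧
      M.varT x₀ (M.feedbackPolicy x₀ (M.targetRule x₀ xtg km kp))
          + (M.meanT x₀ (M.feedbackPolicy x₀ (M.targetRule x₀ xtg km kp)) - c) ^ 2
        = M.dMinus 0 M.sInit * (M.rho 0 * x₀ - c) ^ 2 := by
  set π := M.feedbackPolicy x₀ (M.targetRule x₀ xtg km kp) with hπdef
  have hπ : M.IsAdmissible π := h.isAdmissible_targetRule x₀ xtg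
  have hval := M.lintegral_eq_gapValue h (x₀ := x₀) (c := c) hπ (fun t ht ω => by
    rw [hπdef, M.wealth_feedbackPolicy, feedbackPolicy, M.targetRule_eq km kp _ _ _ ht, ← hc,
      smul_inv_smul₀ (M.rho_pos _).ne'])
  have hmeas : Measurable (M.wealth x₀ π T) :=
    (M.measurable_wealth hπ le_rfl).mono (M.info.le T) le_rfl
  -- Square integrability of the rule's terminal wealth is read off from the finite attained value.
  have hint : Integrable (fun ω => (M.wealth x₀ π T ω - c) ^ 2) P := by
    refine ⟨((hmeas.sub_const c).pow_const 2).aestronglyMeasurable, ?_⟩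
    rw [hasFiniteIntegral_iff_ofReal (Filter.Eventually.of_forall fun _ => sq_nonneg _), hval]
    exact ENNReal.ofReal_lt_top
  have hL2 : MemLp (M.wealth x₀ π T) 2 P := by
    have h1 : MemLp (fun ω => M.wealth x₀ π T ω - c) 2 P :=
      (memLp_two_iff_integrable_sq (hmeas.sub_const c).aestronglyMeasurable).2 hint
    have h2 := h1.add (memLp_const c)
    refine h2.ae_eq (Filter.Eventually.of_forall fun ω => ?_)
    simp
  refine ⟨⟨hπ, hL2⟩, ?_⟩
  rw [← M.integral_sq_sub ⟨hπ, hL2⟩]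
  rw [← ofReal_integral_eq_lintegral_ofReal hint
      (Filter.Eventually.of_forall fun _ => sq_nonneg _), gapValue,
    signedQuad_of_nonpos (sub_nonpos.2 hle)] at hval
  exact (ENNReal.ofReal_eq_ofReal_iff (integral_nonneg fun _ => sq_nonneg _)
    (mul_nonneg (M.d_mem_Icc (Nat.zero_le T) _).1.1 (sq_nonneg _))).1 hval

/-- The initial state is deterministic, so an almost sure statement about it is one at `sInit`. -/
theorem dMinus_zero_pos : 0 < M.dMinus 0 M.sInit := by
  have := (M.isRegularAt (Nat.zero_le T)).pos_minus
  rwa [M.map_s_zero, ae_dirac_eq, Filter.eventually_pure] at this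

end FactorMarket

/-! ### Mean and variance of the target rule, and the efficient frontier -/

/-- A quadratic that is nonnegative on `[0, ∞)` and vanishes at `D` is stationary at `D`, unless
`D = 0`, where it reduces to `v + m ^ 2`. -/
theorem eq_of_quadratic_touches {d v m D : ℝ} (hd : 0 ≤ d) (hv : 0 ≤ v) (hD : 0 ≤ D)
    (hle : ∀ y, 0 ≤ y → d * y ^ 2 ≤ v + (m - y) ^ 2) (heq : v + (m - D) ^ 2 = d * D ^ 2) :
    m = (1 - d) * D := by
  rcases hD.eq_or_lt with rfl | hD
  · have : m ^ 2 = 0 := by nlinarith [sq_nonneg m]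
    simpa using this
  -- `2 e` is the derivative at `D` of `v + (m - y)² - d y²`.
  set e := (1 - d) * D - m with he
  suffices e = 0 by linarith
  have hden : 0 < |e| + D := by positivity
  -- A descent step `y = D - τ e`: this `τ` keeps `y ≥ 0`, and `τ ≤ 1` prevents the second-order
  -- term from absorbing `-2 τ e²`.
  set τ := D / (|e| + D)
  have hτ0 : 0 < τ := by positivity
  have hτ1 : τ ≤ 1 := (div_le_one hden).2 (by linarith [abs_nonneg e])
  have hτe : τ * e ≤ D := by
    have h1 : τ * |e| ≤ D := by
      rw [div_mul_eq_mul_div, div_le_iff₀ hden]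
      nlinarith [abs_nonneg e]
    exact (mul_le_mul_of_nonneg_left (le_abs_self e) hτ0.le).trans h1
  have h2 := hle (D - τ * e) (by linarith)
  have h3 : 0 ≤ -2 * τ * e ^ 2 + (1 - d) * (τ * e) ^ 2 := by
    have : v + (m - (D - τ * e)) ^ 2 - d * (D - τ * e) ^ 2
        = -2 * τ * e ^ 2 + (1 - d) * (τ * e) ^ 2 := by
      rw [he]; linear_combination heq
    linarith
  have h4 : (1 - d) * (τ * e) ^ 2 ≤ τ * e ^ 2 := by
    have h5 : (1 - d) * (τ * e) ^ 2 ≤ 1 * (τ * e) ^ 2 := by gcongr; linarith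
    have h6 : τ * (τ * e ^ 2) ≤ 1 * (τ * e ^ 2) := by gcongr
    linarith [mul_pow τ e 2, show τ * (τ * e ^ 2) = τ ^ 2 * e ^ 2 by ring]
  have h7 : τ * e ^ 2 ≤ 0 := by linarith
  have h8 : e ^ 2 ≤ 0 := nonpos_of_mul_nonpos_right h7 hτ0
  exact pow_eq_zero_iff two_ne_zero |>.1 (le_antisymm h8 (sq_nonneg e))

namespace FactorMarket

variable {Ω : Type*} [mΩ : MeasurableSpace Ω] {P : Measure Ω} [IsProbabilityMeasure P]
  {T N Ns Ne Nx : ℕ} {M : FactorMarket P T N Ns Ne Nx} {x₀ xtg : ℝ}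

/-- The bound of the efficient frontier. -/
theorem IsSquareAdmissible.frontier_le_varT {π : ℕ → Ω → Vec N} (hπ : M.IsSquareAdmissible x₀ π)
    (hd : M.dMinus 0 M.sInit < 1) (hm : M.rho 0 * x₀ ≤ M.meanT x₀ π) :
    M.dMinus 0 M.sInit * (M.meanT x₀ π - M.rho 0 * x₀) ^ 2 / (1 - M.dMinus 0 M.sInit)
      ≤ M.varT x₀ π := by
  set d := M.dMinus 0 M.sInit
  set a := M.rho 0 * x₀
  set m := M.meanT x₀ π
  have hd' : 0 < 1 - d := by linarith
  -- This `c` maximizes `d (c - a)² - (m - c)²`, which is concave in `c` because `d < 1`.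
  have h := M.dMinus_mul_sq_le hπ (c := a + (m - a) / (1 - d))
    (le_add_of_nonneg_right (div_nonneg (by linarith) hd'.le))
  have h1 : d * (a - (a + (m - a) / (1 - d))) ^ 2 - (m - (a + (m - a) / (1 - d))) ^ 2
      = d * (m - a) ^ 2 / (1 - d) := by
    field_simp
    ring
  change d * (a - (a + (m - a) / (1 - d))) ^ 2
    ≤ M.varT x₀ π + (m - (a + (m - a) / (1 - d))) ^ 2 at h
  linarith

variable {km kp : ℕ → Vec Ns → Vec N}

/-- The mean and the variance of the terminal wealth of the target-mean rule. -/
theorem AreMinimizers.targetRule_mean_var (h : M.AreMinimizers km kp) (hx : M.rho 0 * x₀ ≤ xtg)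
    (hd : M.dMinus 0 M.sInit < 1) :
    M.IsSquareAdmissible x₀ (M.feedbackPolicy x₀ (M.targetRule x₀ xtg km kp)) ∧
      M.meanT x₀ (M.feedbackPolicy x₀ (M.targetRule x₀ xtg km kp)) = xtg ∧
      M.varT x₀ (M.feedbackPolicy x₀ (M.targetRule x₀ xtg km kp))
        = M.dMinus 0 M.sInit * (xtg - M.rho 0 * x₀) ^ 2 / (1 - M.dMinus 0 M.sInit) := by
  have hd0 := M.dMinus_zero_pos
  have hd' : 0 < 1 - M.dMinus 0 M.sInit := by linarith
  have hc : M.rho 0 * x₀ + (xtg - M.rho 0 * x₀) / (1 - M.dMinus 0 M.sInit)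
      = (xtg - M.rho 0 * M.dMinus 0 M.sInit * x₀) / (1 - M.dMinus 0 M.sInit) := by
    field_simp
    ring
  have hD : 0 ≤ (xtg - M.rho 0 * x₀) / (1 - M.dMinus 0 M.sInit) :=
    div_nonneg (by linarith) hd'.le
  obtain ⟨hsq, hval⟩ := h.isSquareAdmissible_targetRule hc (le_add_of_nonneg_right hD)
  set π := M.feedbackPolicy x₀ (M.targetRule x₀ xtg km kp)
  -- With `c = ρ_0 x_0 + y`, the bound holds for all `y ≥ 0` and is attained at the rule's own
  -- level; stationarity there determines the mean.
  have hmean := eq_of_quadratic_touches (m := M.meanT x₀ π - M.rho 0 * x₀) hd0.le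
    (variance_nonneg (M.wealth x₀ π T) P) hD
    (fun y hy => by
      have := M.dMinus_mul_sq_le hsq (c := M.rho 0 * x₀ + y) (le_add_of_nonneg_right hy)
      rw [varT] at this
      convert this using 2 <;> ring)
    (by rw [varT] at hval; convert hval using 2 <;> ring)
  rw [mul_div_cancel₀ _ hd'.ne'] at hmean
  have hmean' : M.meanT x₀ π = xtg := by linarith
  refine ⟨hsq, hmean', ?_⟩
  rw [hmean'] at hval
  have h1 : M.dMinus 0 M.sInit * (M.rho 0 * x₀
        - (M.rho 0 * x₀ + (xtg - M.rho 0 * x₀) / (1 - M.dMinus 0 M.sInit))) ^ 2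
      - (xtg - (M.rho 0 * x₀ + (xtg - M.rho 0 * x₀) / (1 - M.dMinus 0 M.sInit))) ^ 2
      = M.dMinus 0 M.sInit * (xtg - M.rho 0 * x₀) ^ 2 / (1 - M.dMinus 0 M.sInit) := by
    field_simp
    ring
  linarith

theorem AreMinimizers.isOptimal_targetRule (h : M.AreMinimizers km kp)
    (hx : M.rho 0 * x₀ ≤ xtg) (hd : M.dMinus 0 M.sInit < 1) :
    M.IsOptimal x₀ xtg (M.feedbackPolicy x₀ (M.targetRule x₀ xtg km kp)) := by
  obtain ⟨hsq, hmean, hvar⟩ := h.targetRule_mean_var hx hd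
  refine ⟨⟨hsq.1, hsq.2.integrable (by norm_num), hmean⟩, hsq.2, fun π' hπ' => ?_⟩
  by_cases hL2 : MemLp (M.wealth x₀ π' T) 2 P
  · rw [← hsq.2.ofReal_variance_eq, ← hL2.ofReal_variance_eq]
    refine ENNReal.ofReal_le_ofReal ?_
    have hmean' : M.meanT x₀ π' = xtg := hπ'.2.2
    have := IsSquareAdmissible.frontier_le_varT ⟨hπ'.1, hL2⟩ hd (hmean' ▸ hx)
    rw [hmean', ← hvar] at this
    exact this
  · rw [evariance_eq_top hπ'.2.1.aestronglyMeasurable hL2]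
    exact le_top

variable (M) in
theorem targetRule_eq_tradeoffRule (hd : M.dMinus 0 M.sInit < 1) (km kp : ℕ → Vec Ns → Vec N) :
    M.targetRule x₀ xtg km kp = M.tradeoffRule x₀ (M.multiplier x₀ xtg) km kp := by
  have hd0 := M.dMinus_zero_pos.ne'
  have hd' : 1 - M.dMinus 0 M.sInit ≠ 0 := by linarith
  funext t x s
  have hr := (M.rho_pos (t + 1)).ne'
  have h1 : (xtg - M.rho 0 * M.dMinus 0 M.sInit * x₀) / (1 - M.dMinus 0 M.sInit)
      = M.rho 0 * x₀ + M.multiplier x₀ xtg / M.dMinus 0 M.sInit := by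
    rw [multiplier]
    field_simp
    ring
  have h2 : (xtg - M.rho 0 * M.dMinus 0 M.sInit * x₀)
        / (M.rho (t + 1) * (1 - M.dMinus 0 M.sInit))
      = (M.rho 0 * x₀ * M.dMinus 0 M.sInit + M.multiplier x₀ xtg)
        / (M.rho (t + 1) * M.dMinus 0 M.sInit) := by
    rw [multiplier]
    field_simp
    ring
  simp only [targetRule, tradeoffRule, h1, h2]

theorem AreMinimizers.lagrangian_le (h : M.AreMinimizers km kp) (hx : M.rho 0 * x₀ ≤ xtg)
    (hd : M.dMinus 0 M.sInit < 1) {π : ℕ → Ω → Vec N} (hπ : M.IsSquareAdmissible x₀ π) :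
    M.varT x₀ (M.feedbackPolicy x₀ (M.targetRule x₀ xtg km kp))
        - 2 * M.multiplier x₀ xtg *
          (M.meanT x₀ (M.feedbackPolicy x₀ (M.targetRule x₀ xtg km kp)) - xtg)
      ≤ M.varT x₀ π - 2 * M.multiplier x₀ xtg * (M.meanT x₀ π - xtg) := by
  obtain ⟨-, hmean, hvar⟩ := h.targetRule_mean_var hx hd
  have hd' : 0 < 1 - M.dMinus 0 M.sInit := by linarith
  set q := M.dMinus 0 M.sInit / (1 - M.dMinus 0 M.sInit) with hq
  have hq0 : 0 ≤ q := div_nonneg M.dMinus_zero_pos.le hd'.le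
  have hmul : M.multiplier x₀ xtg = q * (xtg - M.rho 0 * x₀) := by rw [multiplier, hq]; ring
  have hvar' : M.varT x₀ (M.feedbackPolicy x₀ (M.targetRule x₀ xtg km kp))
      = q * (xtg - M.rho 0 * x₀) ^ 2 := by rw [hvar, hq]; ring
  rw [hmean, hvar', hmul]
  set A := xtg - M.rho 0 * x₀
  set m := M.meanT x₀ π - M.rho 0 * x₀ with hm
  have hA : 0 ≤ A := by simp only [A]; linarith
  have hmA : M.meanT x₀ π - xtg = m - A := by simp only [m, A]; ring
  rw [hmA, sub_self]
  -- Above `ρ_0 x_0` the frontier bound leaves the surplus `q (m - A)²`. Below it `v ≥ 0` suffices,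
  -- since `-2qA(m - A) ≥ 2qA²`.
  rcases le_total 0 m with h0 | h0
  · have h1 := hπ.frontier_le_varT hd (by linarith)
    have h2 : q * m ^ 2 ≤ M.varT x₀ π := by
      refine le_trans (le_of_eq ?_) h1
      rw [hq, hm]
      ring
    nlinarith [mul_nonneg hq0 (sq_nonneg (m - A))]
  · have h1 : 0 ≤ M.varT x₀ π := variance_nonneg _ _
    nlinarith [mul_nonneg (mul_nonneg hq0 hA) (sub_nonneg.2 h0), mul_nonneg hq0 (sq_nonneg A)]

theorem AreMinimizers.efficientFrontier_eq (h : M.AreMinimizers km kp)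
    (hd : M.dMinus 0 M.sInit < 1) :
    M.efficientFrontier x₀ = {p : ℝ × ℝ | M.rho 0 * x₀ ≤ p.1 ∧
      p.2 = M.dMinus 0 M.sInit * (p.1 - M.rho 0 * x₀) ^ 2 / (1 - M.dMinus 0 M.sInit)} := by
  have hd0 := M.dMinus_zero_pos
  have hd' : 0 < 1 - M.dMinus 0 M.sInit := by linarith
  ext ⟨m, v⟩
  constructor
  · rintro ⟨π, hπ, hp, hdom⟩
    obtain ⟨rfl, rfl⟩ := Prod.mk.inj hp
    have hv : 0 ≤ M.varT x₀ π := variance_nonneg _ _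
    have hm : M.rho 0 * x₀ ≤ M.meanT x₀ π := by
      by_contra hlt
      -- The rule with target `ρ_0 x_0` has zero variance and would dominate a policy of smaller
      -- mean.
      obtain ⟨h1, h2, h3⟩ := h.targetRule_mean_var (x₀ := x₀) le_rfl hd
      have h4 := (hdom _ h1 (by rw [h2]; exact (not_le.1 hlt).le)
        (by rw [h3, sub_self]; simpa using hv)).1
      rw [h2] at h4
      exact hlt h4.le
    refine ⟨hm, ?_⟩
    obtain ⟨h1, h2, h3⟩ := h.targetRule_mean_var hm hd
    have h4 := (hdom _ h1 h2.ge (by rw [h3]; exact hπ.frontier_le_varT hd hm)).2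
    rw [← h4, h3]
  · rintro ⟨hm, hv⟩
    simp only at hm hv
    obtain ⟨h1, h2, h3⟩ := h.targetRule_mean_var hm hd
    refine ⟨_, h1, by rw [h2, h3, hv], fun π' hπ' hm' hv' => ?_⟩
    rw [h2] at hm' ⊢
    have h4 := hπ'.frontier_le_varT hd (hm.trans hm')
    rw [h3] at hv' ⊢
    have h5 := h4.trans hv'
    -- As `d_0⁻ > 0`, the frontier variance is strictly increasing for means above `ρ_0 x_0`, so a
    -- dominating policy cannot have a larger mean.
    rw [div_le_div_iff_of_pos_right hd', mul_le_mul_iff_right₀ hd0,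
      sq_le_sq₀ (by linarith) (by linarith)] at h5
    have h6 : M.meanT x₀ π' = m := by linarith
    rw [h6] at h4
    exact ⟨h6, le_antisymm hv' h4⟩

end FactorMarket

theorem theorem2 {Ω : Type*} [mΩ : MeasurableSpace Ω] (P : Measure Ω) [IsProbabilityMeasure P]
    (T N Ns Ne Nx : ℕ) (M : FactorMarket P T N Ns Ne Nx) (x₀ xtg : ℝ) :
    -- the minimizers in the definition of `d⁻` and `d⁺` exist when the cones are closed
    ((∀ t, t < T → IsClosed (M.A t)) → ∃ km kp, M.AreMinimizers km kp) ∧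
    -- (i) infeasibility
    ((M.rho 0 * x₀ < xtg ∧ M.dMinus 0 M.sInit = 1) ∨
        (xtg < M.rho 0 * x₀ ∧ M.dPlus 0 M.sInit = 1) →
      ¬ ∃ π, M.IsFeasible x₀ xtg π) ∧
    -- (ii) the optimal policy, its Lagrange multiplier, and the efficient frontier
    (M.rho 0 * x₀ ≤ xtg → M.dMinus 0 M.sInit < 1 →
      ∀ km kp, M.AreMinimizers km kp →
        M.IsOptimal x₀ xtg (M.feedbackPolicy x₀ (M.targetRule x₀ xtg km kp)) ∧
        M.targetRule x₀ xtg km kp = M.tradeoffRule x₀ (M.multiplier x₀ xtg) km kp ∧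
        (∀ π, M.IsSquareAdmissible x₀ π →
          M.varT x₀ (M.feedbackPolicy x₀ (M.targetRule x₀ xtg km kp))
              - 2 * M.multiplier x₀ xtg *
                (M.meanT x₀ (M.feedbackPolicy x₀ (M.targetRule x₀ xtg km kp)) - xtg)
            ≤ M.varT x₀ π - 2 * M.multiplier x₀ xtg * (M.meanT x₀ π - xtg)) ∧
        M.varT x₀ (M.feedbackPolicy x₀ (M.targetRule x₀ xtg km kp))
          = M.dMinus 0 M.sInit * (xtg - M.rho 0 * x₀) ^ 2 / (1 - M.dMinus 0 M.sInit) ∧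
        M.efficientFrontier x₀ =
          {p : ℝ × ℝ | M.rho 0 * x₀ ≤ p.1 ∧
            p.2 = M.dMinus 0 M.sInit * (p.1 - M.rho 0 * x₀) ^ 2 / (1 - M.dMinus 0 M.sInit)}) := by
  refine ⟨M.exists_areMinimizers, M.not_exists_isFeasible, fun hx hd km kp h => ?_⟩
  exact ⟨h.isOptimal_targetRule hx hd, M.targetRule_eq_tradeoffRule hd km kp,
    fun π hπ => h.lagrangian_le hx hd hπ, (h.targetRule_mean_var hx hd).2.2,
    h.efficientFrontier_eq hd⟩
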